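/- Let $\mathbb{H}$ be the quaternions, $B=B(0;1)=\{q\in\mathbb{H}:\|q\|<1\}$, $\mathbb{S}$ the set of purely imaginary quaternions of norm $1$, and for $I\in\mathbb{S}$ let $\mathbb{C}_I=\{x+Iy : x,y\in\mathbb{R}\}$ and $\mathbb{D}_I=B\cap\mathbb{C}_I$. A real differentiable $f:B\to\mathbb{H}$ is (left) slice regular, $f\in\mathcal{R}(B)$, if $\frac12(\partial_x+I\partial_y)f(x+Iy)=0$ on $\mathbb{D}_I$ for every $I\in\mathbb{S}$; its slice derivative is $\partial_sf(x+Iy)=\frac12(\partial_x-I\partial_y)f(x+Iy)$ (and $\partial_xf(x)$ at real points). It is intrinsic, $f\in\mathcal{N}(B)$, if moreover $f(\mathbb{D}_I)\subseteq\mathbb{C}_I$ for all $I\in\mathbb{S}$. For slice regular $f=\alpha+I\beta$, $g=\gamma+I\delta$ (with $\alpha,\beta,\gamma,\delta$ functions of $(x,y)$ independent of $I$) put $f*g=(\alpha\gamma-\beta\delta)+I(\alpha\delta+\beta\gamma)$, $f^c=\overline{\alpha}+I\overline{\beta}$, $f^s=f*f^c$ and $f^{-*}=(f^s)^{-1}f^c$,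 the last off the zeros of $f^s$. For $f\in\mathcal{R}(B)$ with $f(0)=0$ and $\partial_sf(0)=1$, call $f$ starlike if $f$ is injective on $B$ and $f(B)$ is starlike with respect to $0$; for $I\in\mathbb{S}$ call $f$ $I$-starlike (resp. $I$-convex) if $f$ is injective on $\mathbb{D}_I$ and $f(\mathbb{D}_I)$ is starlike with respect to $0$ (resp. convex). Let $\mathcal{P}_I=\{p\in\mathcal{R}(B): p(0)=1,\ \operatorname{Re}p(z)>0 \text{ for } z\in\mathbb{D}_I\}$; a function defined by means of $g^{-*}$ is said to belong to $\mathcal{P}_I$ if it is the restriction to $\{q\in B: g^s(q)\neq0\}$ of a function in $\mathcal{P}_I$ (removable singularities are removed). A rotation of $g$ is a function $q\mapsto e^{-I\varphi}g(e^{I\varphi}q)$ with $I\in\mathbb{S}$, $\varphi\in\mathbb{R}$, $e^{I\varphi}=\cos\varphi+I\sin\varphi$. Theorem. Let $f\in\mathcal{N}(B)$ with $f(0)=0$ and $\partial_sf(0)=1$, and let $f(q)=\sum_{n\ge0}q^na_n$ be its (always existing) power series expansion on $B$. 1. $f$ is starlike if and only if $q\,\partial_sf(q)*f(q)^{-*}$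 belongs to $\mathcal{P}_I$ for every $I\in\mathbb{S}$. 2. For every $I\in\mathbb{S}$: $f$ is $I$-convex if and only if $1+q\,\partial_s^2f(q)*(\partial_sf(q))^{-*}$ belongs to $\mathcal{P}_I$. 3. For every $I\in\mathbb{S}$: $f$ is $I$-convex if and only if $q*\partial_sf(q)$ is $I$-starlike. 4. If $f$ is starlike, then $\|a_n\|\le n$ for all $n\in\mathbb{N}$; and if $f$ is not a rotation of the Koebe function $K(q)=q[(1-q)^2]^{-1}$, then $\|a_n\|<n$ for all $n\ge2$. 5. For every $I\in\mathbb{S}$: if $f$ is $I$-convex, then $\|a_n\|\le1$ for all $n\ge2$; and if $f$ is not a rotation of $q(1-q)^{-1}$, then $\|a_n\|<1$ for all $n\ge2$. 6. For every $I\in\mathbb{S}$: if $f$ is $I$-convex, then $B(0;1/2)\cap\mathbb{C}_I\subseteq f(\mathbb{D}_I)$. -/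

import Mathlib

open scoped Quaternion

noncomputable section

namespace SliceQuat

/-- The sphere of imaginary units: purely imaginary quaternions of norm one. -/
def imagUnits : Set ℍ[ℝ] := {I | I.re = 0 ∧ ‖I‖ = 1}

/-- The point `x + I y`. -/
def pt (I : ℍ[ℝ]) (x y : ℝ) : ℍ[ℝ] := (x : ℍ[ℝ]) + I * (y : ℍ[ℝ])

/-- The complex plane `ℂ_I = {x + I y}`. -/
def slicePlane (I : ℍ[ℝ]) : Set ℍ[ℝ] := {q | ∃ x y : ℝ, q = pt I x y}

/-- The open unit ball of the quaternions. -/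
def unitBall : Set ℍ[ℝ] := Metric.ball 0 1

/-- The slice `𝔻_I` of the unit ball. -/
def sliceDisc (I : ℍ[ℝ]) : Set ℍ[ℝ] := unitBall ∩ slicePlane I

/-- `∂/∂x` of the restriction of `f` to `ℂ_I`, at `x + I y`. -/
def partialX (I : ℍ[ℝ]) (f : ℍ[ℝ] → ℍ[ℝ]) (x y : ℝ) : ℍ[ℝ] := deriv (fun s : ℝ => f (pt I s y)) x

/-- `∂/∂y` of the restriction of `f` to `ℂ_I`, at `x + I y`. -/
def partialY (I : ℍ[ℝ]) (f : ℍ[ℝ] → ℍ[ℝ]) (x y : ℝ) : ℍ[ℝ] := deriv (fun t : ℝ => f (pt I x t)) y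

/-- Left slice regularity on (the open set) `U`: real differentiable, and
`½ (∂/∂x + I ∂/∂y) f_I = 0` on `U ∩ ℂ_I` for every imaginary unit `I`. -/
def SliceRegularOn (U : Set ℍ[ℝ]) (f : ℍ[ℝ] → ℍ[ℝ]) : Prop :=
  DifferentiableOn ℝ f U ∧
    ∀ I ∈ imagUnits, ∀ x y : ℝ, pt I x y ∈ U →
      (1 / 2 : ℝ) • (partialX I f x y + I * partialY I f x y) = 0

/-- The class `𝒩(U)` of quaternionic intrinsic functions: slice regular functions on `U` that map
`U ∩ ℂ_I` into `ℂ_I` for every imaginary unit `I`. -/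
def Intrinsic (U : Set ℍ[ℝ]) (f : ℍ[ℝ] → ℍ[ℝ]) : Prop :=
  SliceRegularOn U f ∧ ∀ I ∈ imagUnits, Set.MapsTo f (U ∩ slicePlane I) (slicePlane I)

/-- The imaginary unit `I_q` of a non-real quaternion `q`, so that `q = re q + I_q ‖im q‖`
(it is `0` when `q` is real). -/
def unitOf (q : ℍ[ℝ]) : ℍ[ℝ] := ‖q.im‖⁻¹ • q.im

open Classical in
/-- The slice derivative `∂_s f`: at a non-real `q = x + I y` it is `½ (∂/∂x - I ∂/∂y) f_I`, written
here with `I = I_q` and `y = ‖im q‖ > 0` (replacing `(I, y)` by `(-I, -y)` changes nothing);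
at a real point it is the derivative along the real axis. -/
def sliceDeriv (f : ℍ[ℝ] → ℍ[ℝ]) (q : ℍ[ℝ]) : ℍ[ℝ] :=
  if q.im = 0 then deriv (fun s : ℝ => f (s : ℍ[ℝ])) q.re
  else (1 / 2 : ℝ) •
    (partialX (unitOf q) f q.re ‖q.im‖ - unitOf q * partialY (unitOf q) f q.re ‖q.im‖)

/-- The component `α` in `f (x + I y) = α (x, y) + I β (x, y)`, as a function of `q = x + I_q y`
with `y = ‖im q‖`. -/
def alphaPart (f : ℍ[ℝ] → ℍ[ℝ]) (q : ℍ[ℝ]) : ℍ[ℝ] := (1 / 2 : ℝ) • (f q + f (star q))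

/-- The component `β` in `f (x + I y) = α (x, y) + I β (x, y)`, as a function of `q = x + I_q y`
with `y = ‖im q‖`; it vanishes at real points. -/
def betaPart (f : ℍ[ℝ] → ℍ[ℝ]) (q : ℍ[ℝ]) : ℍ[ℝ] :=
  (1 / 2 : ℝ) • (unitOf q * (f (star q) - f q))

/-- The slice product of `f = α + I β` and `g = γ + I δ`:
`f * g = (α γ - β δ) + I (α δ + β γ)`. -/
def starMul (f g : ℍ[ℝ] → ℍ[ℝ]) (q : ℍ[ℝ]) : ℍ[ℝ] :=
  (alphaPart f q * alphaPart g q - betaPart f q * betaPart g q) +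
    unitOf q * (alphaPart f q * betaPart g q + betaPart f q * alphaPart g q)

/-- The slice regular conjugate `f^c = conj α + I conj β` of `f = α + I β`. -/
def regConj (f : ℍ[ℝ] → ℍ[ℝ]) (q : ℍ[ℝ]) : ℍ[ℝ] :=
  star (alphaPart f q) + unitOf q * star (betaPart f q)

/-- The symmetrization `f^s = f * f^c`. -/
def symmetrization (f : ℍ[ℝ] → ℍ[ℝ]) : ℍ[ℝ] → ℍ[ℝ] := starMul f (regConj f)

/-- The slice regular inverse `f^{-*} = (f^s)⁻¹ f^c`; it is meaningful off the zeros of `f^s`. -/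
def starInv (f : ℍ[ℝ] → ℍ[ℝ]) (q : ℍ[ℝ]) : ℍ[ℝ] := (symmetrization f q)⁻¹ * regConj f q

/-- The class `𝒫_I` of slice regular functions on the unit ball with positive real part on `𝔻_I` and
value `1` at the origin. -/
def CaratheodoryClass (I : ℍ[ℝ]) : Set (ℍ[ℝ] → ℍ[ℝ]) :=
  {p | SliceRegularOn unitBall p ∧ (∀ z ∈ sliceDisc I, 0 < (p z).re) ∧ p 0 = 1}

/-- A function `h` built with `g^{-*}` is a priori given only on the unit ball without the zeros of
`g^s`. It belongs to `𝒫_I` when it is the restriction of a member of `𝒫_I`, that is, when its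
singularities are removable and the function so obtained is in `𝒫_I`. -/
def BelongsToCaratheodory (I : ℍ[ℝ]) (g h : ℍ[ℝ] → ℍ[ℝ]) : Prop :=
  ∃ p ∈ CaratheodoryClass I, ∀ q ∈ unitBall, symmetrization g q ≠ 0 → p q = h q

/-- The normalization `f(0) = 0`, `∂_s f(0) = 1` for a slice regular function on the unit ball. -/
def Normalized (f : ℍ[ℝ] → ℍ[ℝ]) : Prop :=
  SliceRegularOn unitBall f ∧ f 0 = 0 ∧ sliceDeriv f 0 = 1

/-- Starlike functions: normalized, univalent in the unit ball, with starlike image. -/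
def IsStarlike (f : ℍ[ℝ] → ℍ[ℝ]) : Prop :=
  Normalized f ∧ Set.InjOn f unitBall ∧ StarConvex ℝ 0 (f '' unitBall)

/-- `I`-starlike functions: normalized, univalent on `𝔻_I`, with `f(𝔻_I)` starlike. -/
def IsSliceStarlike (I : ℍ[ℝ]) (f : ℍ[ℝ] → ℍ[ℝ]) : Prop :=
  Normalized f ∧ Set.InjOn f (sliceDisc I) ∧ StarConvex ℝ 0 (f '' sliceDisc I)

/-- `I`-convex functions: normalized, univalent on `𝔻_I`, with `f(𝔻_I)` convex. -/
def IsSliceConvex (I : ℍ[ℝ]) (f : ℍ[ℝ] → ℍ[ℝ]) : Prop :=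
  Normalized f ∧ Set.InjOn f (sliceDisc I) ∧ Convex ℝ (f '' sliceDisc I)

/-- The quaternionic Koebe function `q [(1 - q)²]⁻¹`. -/
def koebe (q : ℍ[ℝ]) : ℍ[ℝ] := q * ((1 - q) ^ 2)⁻¹

/-- The function `q (1 - q)⁻¹`. -/
def halfSpaceMap (q : ℍ[ℝ]) : ℍ[ℝ] := q * (1 - q)⁻¹

/-- The exponential `e^{I φ} = cos φ + I sin φ`. -/
def expI (I : ℍ[ℝ]) (φ : ℝ) : ℍ[ℝ] := pt I (Real.cos φ) (Real.sin φ)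

/-- `f` is a rotation `q ↦ e^{-I φ} g(e^{I φ} q)` of `g` on the unit ball. -/
def IsRotationOf (f g : ℍ[ℝ] → ℍ[ℝ]) : Prop :=
  ∃ I ∈ imagUnits, ∃ φ : ℝ, ∀ q ∈ unitBall, f q = expI I (-φ) * g (expI I φ * q)

end SliceQuat

end

/-! An intrinsic function is one symmetric holomorphic function in disguise. On every slice `f` is a
copy of a single `F` on the unit disc with `F (conj z) = conj (F z)` (`exists_isLift_of_intrinsic`):
each slice carries a holomorphic function, `f` is real at real points because `ℂ_i ∩ ℂ_j = ℝ`, and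
the identity theorem makes all slices agree. For such functions the components `α`, `β` are real, so
slice product, regular conjugate, regular inverse and slice derivative become the product, identity,
inverse and derivative of `F`. Each assertion then reduces to a classical theorem on univalent
functions.

The classical theory is organized around a logarithm `H` and the single condition `Re (1 + z H') >
0`: `F` is starlike iff `F = z exp H`, and convex iff `F' = exp H`, with this condition on `H`
(`starlike_iff_exists_exp`, `convex_iff_exists_exp`). Alexander's theorem is immediate, since the
same `H` serves for `F` and `z F'`. Sufficiency is geometric: radial segments pull back to curves
approaching the origin in the starlike case, and image circles lie on one side of their tangents in
the convex case. Necessity is Schwarz's lemma applied to `F⁻¹ ∘ K`, where `K` is a multiple of `F`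
or a mean of two rotated copies of `F`.

The coefficient bounds come from `z F' = F P` with `P = 1 + z H'`, Carathéodory's `|p_n| ≤ 2` and
induction; equality forces `|p_1| = 2`, which determines `P` and hence `F`. The coefficients of `F`
are real by symmetry, so the only extremal rotations are by the angles `0` and `π`. The disc of
radius `1/2` comes from a separating functional and `|p_1| ≤ 2`. -/

namespace SliceQuat

/-! ### Logarithms, univalence and one-sided derivatives -/

open Complex Metric Set Filter Topology

/-- If `z g' = (P - 1) g` off the zeros of `g` and `g 0 = P 0 = 1`,
then `g` has no zeros: it is the exponential of a function `H` with `P = 1 + z H'`. -/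
theorem exists_exp_of_mul_deriv {g P : ℂ → ℂ} (hg : DifferentiableOn ℂ g (ball 0 1))
    (hP : DifferentiableOn ℂ P (ball 0 1)) (hg0 : g 0 = 1) (hP0 : P 0 = 1)
    (h : ∀ z ∈ ball (0 : ℂ) 1, g z ≠ 0 → z * deriv g z = (P z - 1) * g z) :
    ∃ H : ℂ → ℂ, DifferentiableOn ℂ H (ball 0 1) ∧ H 0 = 0 ∧
      (∀ z ∈ ball (0 : ℂ) 1, g z = exp (H z)) ∧
      ∀ z ∈ ball (0 : ℂ) 1, P z = 1 + z * deriv H z := by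
  have h0 : (0 : ℂ) ∈ ball (0 : ℂ) 1 := mem_ball_self one_pos
  have hM : DifferentiableOn ℂ (dslope P 0) (ball 0 1) :=
    (differentiableOn_dslope (isOpen_ball.mem_nhds h0)).2 hP
  obtain ⟨H, hH0, hH⟩ := hM.isExactOn_ball.with_val_at 0 0
  have hPM : ∀ z, P z = 1 + z * dslope P 0 z := fun z => by
    have := sub_smul_dslope P 0 z
    simp only [sub_zero, smul_eq_mul, hP0] at this
    rw [this]; ring
  have hHd : DifferentiableOn ℂ H (ball 0 1) := fun z hz =>
    (hH z hz).differentiableAt.differentiableWithinAt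
  set k : ℂ → ℂ := fun z => g z * exp (-H z) with hk
  have hkd : ∀ z ∈ ball (0 : ℂ) 1,
      HasDerivAt k ((deriv g z - dslope P 0 z * g z) * exp (-H z)) z := fun z hz => by
    have h1 := (hg.differentiableAt (isOpen_ball.mem_nhds hz)).hasDerivAt
    have h2 := (hH z hz).neg.cexp
    exact (h1.mul h2).congr_deriv (by simp only [Pi.neg_apply]; ring)
  have hkD : DifferentiableOn ℂ k (ball 0 1) := fun z hz =>
    (hkd z hz).differentiableAt.differentiableWithinAt
  -- The equation is usable only where `g ≠ 0`, which holds near `0` because `g 0 = 1`. There `k' =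
  -- 0` after cancelling `z`, and the identity theorem carries this to the whole disc, including
  -- possible zeros of `g`.
  have hk' : EqOn (deriv k) 0 (ball 0 1) := by
    refine ((hkD.deriv isOpen_ball).analyticOnNhd
      isOpen_ball).eqOn_zero_of_preconnected_of_frequently_eq_zero
      (convex_ball _ _).isPreconnected h0 (Eventually.frequently ?_)
    have hgc : ∀ᶠ z in 𝓝 (0 : ℂ), g z ≠ 0 :=
      (hg.differentiableAt (isOpen_ball.mem_nhds h0)).continuousAt.eventually_ne
        (by rw [hg0]; exact one_ne_zero)
    filter_upwards [nhdsWithin_le_nhds hgc, nhdsWithin_le_nhds (isOpen_ball.mem_nhds h0),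
      self_mem_nhdsWithin] with z hz1 hz2 hz3
    have h3 := h z hz2 hz1
    rw [hPM z] at h3
    have h4 : deriv g z = dslope P 0 z * g z :=
      mul_left_cancel₀ (show z ≠ 0 from hz3) (by rw [h3]; ring)
    rw [(hkd z hz2).deriv, h4, sub_self, zero_mul]
  have hk1 : ∀ z ∈ ball (0 : ℂ) 1, k z = 1 := fun z hz => by
    have := isOpen_ball.is_const_of_deriv_eq_zero (convex_ball (0 : ℂ) 1).isPreconnected
      hkD hk' hz h0
    rw [this]; simp [hk, hg0, hH0]
  refine ⟨H, hHd, hH0, fun z hz => ?_, fun z hz => ?_⟩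
  · have := hk1 z hz
    simp only [hk, exp_neg] at this
    exact (mul_inv_eq_one₀ (exp_ne_zero _)).1 this
  · rw [hPM z, (hH z hz).deriv]

/-- The Noshiro–Warschawski criterion. -/
theorem injOn_of_re_deriv_pos {s : Set ℂ} (hs : Convex ℝ s) {L L' : ℂ → ℂ}
    (hL : ∀ z ∈ s, HasDerivAt L (L' z) z) (hpos : ∀ z ∈ s, 0 < (L' z).re) : InjOn L s := by
  intro a ha b hb hab
  by_contra hne
  have hmem : ∀ t ∈ Icc (0 : ℝ) 1, a + t * (b - a) ∈ s := fun t ht => by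
    have := hs.add_smul_sub_mem ha hb ht
    simpa using this
  -- Along the segment, the component of `L` in the direction `b - a` has derivative `|b - a|² Re L'
  -- > 0`, so it cannot take equal values at both ends.
  have hd : ∀ t ∈ Icc (0 : ℝ) 1, HasDerivAt
      (fun t : ℝ => ((starRingEnd ℂ) (b - a) * L (a + t * (b - a))).re)
      ((starRingEnd ℂ) (b - a) * (L' (a + t * (b - a)) * (b - a))).re t := fun t ht => by
    have h1 : HasDerivAt (fun w : ℂ => a + w * (b - a)) (b - a) (t : ℂ) := by
      simpa using ((hasDerivAt_id (t : ℂ)).mul_const (b - a)).const_add a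
    have h2 := (hL _ (hmem t ht)).comp (t : ℂ) h1
    exact (h2.const_mul _).real_of_complex
  have hval : ∀ t ∈ Icc (0 : ℝ) 1,
      0 < ((starRingEnd ℂ) (b - a) * (L' (a + t * (b - a)) * (b - a))).re := fun t ht => by
    have : (starRingEnd ℂ) (b - a) * (L' (a + t * (b - a)) * (b - a)) =
        ((normSq (b - a) : ℝ) : ℂ) * L' (a + t * (b - a)) := by
      rw [normSq_eq_conj_mul_self]; ring
    rw [this, re_ofReal_mul]
    exact mul_pos (normSq_pos.2 (sub_ne_zero.2 (Ne.symm hne))) (hpos _ (hmem t ht))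
  have := strictMonoOn_of_deriv_pos (convex_Icc (0 : ℝ) 1)
    (fun t ht => (hd t ht).continuousAt.continuousWithinAt)
    (fun t ht => by
      rw [(hd t (interior_subset ht)).deriv]; exact hval t (interior_subset ht))
  have := this (left_mem_Icc.2 zero_le_one) (right_mem_Icc.2 zero_le_one) one_pos
  simp [hab] at this

/-- A univalent function has open image, nonvanishing derivative and a holomorphic inverse. -/
theorem exists_inverse_of_injOn {U : Set ℂ} (hU : IsOpen U) {F : ℂ → ℂ}
    (hF : DifferentiableOn ℂ F U) (hinj : InjOn F U) :
    IsOpen (F '' U) ∧ (∀ z ∈ U, deriv F z ≠ 0) ∧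
      ∃ G : ℂ → ℂ, LeftInvOn G F U ∧ ∀ z ∈ U, HasDerivAt G (deriv F z)⁻¹ (F z) := by
  have hFan := hF.analyticOnNhd hU
  have hnc : ∀ z ∈ U, ¬ ∀ᶠ w in 𝓝 z, F w = F z := fun z hz hc => by
    have h1 : ∀ᶠ w in 𝓝[≠] z, w = z := by
      filter_upwards [nhdsWithin_le_nhds hc, nhdsWithin_le_nhds (hU.mem_nhds hz)] with w h1 h2
      exact hinj h2 hz h1
    obtain ⟨w, h1, h2⟩ := (h1.and self_mem_nhdsWithin).exists
    exact h2 h1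
  have hle : ∀ z ∈ U, 𝓝 (F z) ≤ map F (𝓝 z) := fun z hz =>
    ((hFan z hz).eventually_constant_or_nhds_le_map_nhds).resolve_left (hnc z hz)
  have hopen : IsOpen (F '' U) := isOpen_iff_mem_nhds.2 (by
    rintro _ ⟨z, hz, rfl⟩
    exact hle z hz (image_mem_map (hU.mem_nhds hz)))
  set G := Function.invFunOn F U with hG
  have hGF : LeftInvOn G F U := hinj.leftInvOn_invFunOn
  have hFG : ∀ z ∈ U, ∀ᶠ w in 𝓝 (F z), F (G w) = w := fun z hz => by
    filter_upwards [hopen.mem_nhds (mem_image_of_mem F hz)] with w hw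
    exact Function.invFunOn_eq hw
  have hGc : ∀ z ∈ U, ContinuousAt G (F z) := fun z hz => by
    rw [ContinuousAt, hGF hz]
    refine Tendsto.mono_left ?_ (hle z hz)
    rw [tendsto_map'_iff]
    refine tendsto_id.congr' ?_
    filter_upwards [hU.mem_nhds hz] with w hw
    exact (hGF hw).symm
  have hder : ∀ z ∈ U, deriv F z ≠ 0 → HasDerivAt G (deriv F z)⁻¹ (F z) := fun z hz hne => by
    refine HasDerivAt.of_local_left_inverse (hGc z hz) ?_ hne (hFG z hz)
    rw [hGF hz]
    exact (hF.differentiableAt (hU.mem_nhds hz)).hasDerivAt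
  -- A zero of `F'` is isolated, since otherwise `F` is locally constant. Hence `G` is holomorphic
  -- on a punctured neighbourhood of `F z` and continuous there, so the singularity is removable;
  -- differentiating `G ∘ F = id` at `z` then gives `0 = 1`.
  have hne : ∀ z ∈ U, deriv F z ≠ 0 := fun z hz h0 => by
    have hev : ∀ᶠ w in 𝓝[≠] z, deriv F w ≠ 0 := by
      refine ((hFan z hz).deriv.eventually_eq_zero_or_eventually_ne_zero).resolve_left ?_
      intro hzero
      obtain ⟨ε, hε, hball⟩ := Metric.eventually_nhds_iff_ball.1
        (hzero.and (hU.mem_nhds hz))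
      refine hnc z hz ?_
      filter_upwards [ball_mem_nhds z hε] with w hw
      exact isOpen_ball.is_const_of_deriv_eq_zero (convex_ball z ε).isPreconnected
        (hF.mono fun x hx => (hball x hx).2) (fun x hx => (hball x hx).1) hw (mem_ball_self hε)
    have hGd : ∀ᶠ w in 𝓝[≠] F z, DifferentiableAt ℂ G w := by
      have h1 : ∀ᶠ w in 𝓝 z, w ≠ z → w ∈ U ∧ deriv F w ≠ 0 := by
        filter_upwards [eventually_nhdsWithin_iff.1 hev, hU.mem_nhds hz] with w h1 h2 h3
        exact ⟨h2, h1 h3⟩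
      rw [eventually_nhdsWithin_iff]
      refine (hle z hz) ?_
      rw [mem_map]
      filter_upwards [h1] with w hw hwne
      obtain ⟨h2, h3⟩ := hw (fun h => hwne (by rw [h]; rfl))
      exact (hder w h2 h3).differentiableAt
    have hGz := (analyticAt_of_differentiable_on_punctured_nhds_of_continuousAt hGd
      (hGc z hz)).differentiableAt.hasDerivAt
    have h1 := hGz.comp z (hF.differentiableAt (hU.mem_nhds hz)).hasDerivAt
    rw [h0, mul_zero] at h1
    have h2 : HasDerivAt (G ∘ F) 1 z := (hasDerivAt_id z).congr_of_eventuallyEq (by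
      filter_upwards [hU.mem_nhds hz] with w hw using hGF hw)
    exact zero_ne_one (h1.unique h2)
  exact ⟨hopen, hne, G, hGF, fun z hz => hder z hz (hne z hz)⟩

/-- One-sided derivatives are needed because the curve used for convex images is a function of `√s`,
differentiable at `0` only from the right. -/
theorem eventually_lt_of_hasDerivWithinAt_pos {φ : ℝ → ℝ} {d x : ℝ}
    (h : HasDerivWithinAt φ d (Ici x) x) (hd : 0 < d) : ∀ᶠ s in 𝓝[>] x, φ x < φ s := by
  have h1 := (hasDerivWithinAt_iff_tendsto_slope.1 h)
  rw [Ici_sdiff_left] at h1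
  filter_upwards [h1.eventually (lt_mem_nhds hd), self_mem_nhdsWithin] with s hs hs2
  rw [slope_def_field] at hs
  have := (div_pos_iff_of_pos_right (sub_pos.2 hs2)).1 hs
  linarith

theorem hasDerivWithinAt_normSq {γ : ℝ → ℂ} {v : ℂ} {x : ℝ} {s : Set ℝ}
    (h : HasDerivWithinAt γ v s x) :
    HasDerivWithinAt (fun t => ‖γ t‖ ^ 2) (2 * ((starRingEnd ℂ) (γ x) * v).re) s x := by
  refine h.norm_sq.congr_deriv ?_
  rw [Complex.inner, mul_comm v]

theorem eventually_norm_lt_of_re_neg {γ : ℝ → ℂ} {v : ℂ} {x : ℝ}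
    (h : HasDerivWithinAt γ v (Ici x) x) (hv : ((starRingEnd ℂ) (γ x) * v).re < 0) :
    ∀ᶠ s in 𝓝[>] x, ‖γ s‖ < ‖γ x‖ := by
  filter_upwards [eventually_lt_of_hasDerivWithinAt_pos (hasDerivWithinAt_normSq h).neg
    (by linarith)] with s hs
  simp only [Pi.neg_apply, neg_lt_neg_iff] at hs
  exact lt_of_pow_lt_pow_left₀ 2 (norm_nonneg _) hs

theorem re_nonpos_of_norm_le {γ : ℝ → ℂ} {v : ℂ} {x : ℝ}
    (h : HasDerivWithinAt γ v (Ici x) x) (hle : ∀ᶠ s in 𝓝[>] x, ‖γ s‖ ≤ ‖γ x‖) :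
    ((starRingEnd ℂ) (γ x) * v).re ≤ 0 := by
  by_contra! hv
  obtain ⟨s, h1, h2⟩ := ((eventually_lt_of_hasDerivWithinAt_pos (hasDerivWithinAt_normSq h)
    (by linarith)).and hle).exists
  exact absurd (lt_of_pow_lt_pow_left₀ 2 (norm_nonneg _) h1) (not_lt.2 h2)

/-! ### Sufficiency for starlike functions -/

theorem hasDerivAt_id_mul_exp {H : ℂ → ℂ} (hH : DifferentiableOn ℂ H (ball 0 1)) {z : ℂ}
    (hz : z ∈ ball (0 : ℂ) 1) :
    HasDerivAt (fun z => z * exp (H z)) (exp (H z) * (1 + z * deriv H z)) z := by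
  have h1 := (hH.differentiableAt (isOpen_ball.mem_nhds hz)).hasDerivAt
  exact ((hasDerivAt_id z).mul h1.cexp).congr_deriv (by simp only [id]; ring)

/-- With `z = exp ζ`, a logarithm of `z exp (H z)` is `ζ + H (exp ζ)` on the left half-plane, whose
derivative `1 + z H'` has positive real part; the Noshiro–Warschawski criterion applies. Two
logarithms of the same value differ by `2πi n`, which can be absorbed into `ζ`. -/
theorem injOn_id_mul_exp {H : ℂ → ℂ} (hH : DifferentiableOn ℂ H (ball 0 1))
    (hpos : ∀ z ∈ ball (0 : ℂ) 1, 0 < (1 + z * deriv H z).re) :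
    InjOn (fun z => z * exp (H z)) (ball 0 1) := by
  intro z₁ h₁ z₂ h₂ h
  simp only at h
  rcases eq_or_ne z₁ 0 with rfl | hz₁
  · rw [zero_mul, eq_comm, mul_eq_zero] at h
    exact (h.resolve_right (exp_ne_zero _)).symm
  rcases eq_or_ne z₂ 0 with rfl | hz₂
  · rw [zero_mul, mul_eq_zero] at h
    exact h.resolve_right (exp_ne_zero _)
  have hmem : ∀ ζ : ℂ, ζ.re < 0 → exp ζ ∈ ball (0 : ℂ) 1 := fun ζ hζ => by
    rw [mem_ball_zero_iff, norm_exp]; simpa using hζ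
  have hL : InjOn (fun ζ => ζ + H (exp ζ)) {ζ : ℂ | ζ.re < 0} := by
    refine injOn_of_re_deriv_pos (convex_halfSpace_re_lt 0)
      (L' := fun ζ => 1 + exp ζ * deriv H (exp ζ)) (fun ζ hζ => ?_)
      fun ζ hζ => hpos _ (hmem ζ hζ)
    have h1 := (hH.differentiableAt (isOpen_ball.mem_nhds (hmem ζ hζ))).hasDerivAt
    exact ((hasDerivAt_id ζ).add (h1.comp ζ (hasDerivAt_exp ζ))).congr_deriv (by ring)
  have hlog : ∀ z : ℂ, z ∈ ball (0 : ℂ) 1 → z ≠ 0 → (log z).re < 0 := fun z hz hne => by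
    rw [log_re]
    exact Real.log_neg (norm_pos_iff.2 hne) (mem_ball_zero_iff.1 hz)
  have hexp : exp (log z₁ + H z₁) = exp (log z₂ + H z₂) := by
    rw [exp_add, exp_add, exp_log hz₁, exp_log hz₂, h]
  obtain ⟨n, hn⟩ := exp_eq_exp_iff_exists_int.1 hexp
  have he : exp (log z₂ + n * (2 * Real.pi * I)) = z₂ := by
    rw [exp_add, exp_log hz₂, exp_int_mul_two_pi_mul_I, mul_one]
  have hre : (log z₂ + n * (2 * Real.pi * I)).re < 0 := by
    have := hlog z₂ h₂ hz₂
    have h3 : ((n : ℂ) * (2 * Real.pi * I)).re = 0 := by simp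
    rw [add_re, h3]; linarith
  have := hL (hlog z₁ h₁ hz₁) hre (by
    simp only [he, exp_log hz₁]; rw [hn]; ring)
  rw [← exp_log hz₁, this, he]

/-- Pull the segment from `F z₀` to `0` back through the inverse. The speed of the pulled-back curve
at `z` is a negative multiple of `z / (1 + z H')`, so its modulus decreases and the curve never
leaves the closed disc of radius `‖z₀‖`. -/
theorem starConvex_id_mul_exp {H : ℂ → ℂ} (hH : DifferentiableOn ℂ H (ball 0 1))
    (hpos : ∀ z ∈ ball (0 : ℂ) 1, 0 < (1 + z * deriv H z).re) :
    StarConvex ℝ 0 ((fun z => z * exp (H z)) '' ball 0 1) := by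
  set F : ℂ → ℂ := fun z => z * exp (H z) with hF
  have hFd : DifferentiableOn ℂ F (ball 0 1) := fun z hz =>
    (hasDerivAt_id_mul_exp hH hz).differentiableAt.differentiableWithinAt
  obtain ⟨hopen, -, G, hGF, hG⟩ := exists_inverse_of_injOn isOpen_ball hFd
    (injOn_id_mul_exp hH hpos)
  rw [starConvex_zero_iff]
  rintro _ ⟨z₀, hz₀, rfl⟩ a ha0 ha1
  have hsub : closedBall (0 : ℂ) ‖z₀‖ ⊆ ball 0 1 :=
    closedBall_subset_ball (mem_ball_zero_iff.1 hz₀)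
  set S : Set ℝ := {s | (1 - s) • F z₀ ∈ F '' closedBall 0 ‖z₀‖} with hS
  have hclosed : IsClosed S :=
    (((isCompact_closedBall (0 : ℂ) ‖z₀‖).image_of_continuousOn
      (hFd.continuousOn.mono hsub)).isClosed).preimage (by fun_prop)
  -- Continuous induction: `S` is closed by compactness of the disc, and from each of its points in
  -- `[0, 1)` it extends to the right.
  have hsub2 : Icc (0 : ℝ) 1 ⊆ S := by
    refine IsClosed.Icc_subset_of_forall_mem_nhdsWithin (hclosed.inter isClosed_Icc) ?_ ?_
    · exact ⟨z₀, by simp, by simp⟩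
    rintro x ⟨⟨z, hz, hzx⟩, hx0, hx1⟩
    have hx : (0 : ℝ) < 1 - x := by linarith
    have hz1 := hsub hz
    rcases eq_or_ne z 0 with rfl | hzne
    · have hF0 : F z₀ = 0 := by
        have : F 0 = 0 := by simp [hF]
        rw [this, eq_comm, smul_eq_zero] at hzx
        exact hzx.resolve_left hx.ne'
      exact Filter.Eventually.of_forall fun s =>
        ⟨0, by simp, by rw [hF0]; simp [hF]⟩
    have hFz := hasDerivAt_id_mul_exp hH hz1
    have hpath : HasDerivAt (fun s : ℝ => (1 - s) • F z₀) (-F z₀) x := by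
      simpa using (((hasDerivAt_id x).const_sub 1).smul_const (F z₀))
    have hγ : HasDerivAt (fun s : ℝ => G ((1 - s) • F z₀)) ((deriv F z)⁻¹ * -F z₀) x := by
      have hGz := hG z hz1
      rw [hzx] at hGz
      exact hGz.comp_of_eq x hpath rfl
    have hG0 : G ((1 - x) • F z₀) = z := by rw [← hzx, hGF hz1]
    have hlt := eventually_norm_lt_of_re_neg hγ.hasDerivWithinAt (by
      rw [hG0, hFz.deriv]
      have hFz0 : F z₀ = ((1 - x)⁻¹ : ℝ) * (z * exp (H z)) := by
        have : z * exp (H z) = (1 - x) • F z₀ := hzx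
        rw [this, real_smul, ← mul_assoc, ← ofReal_mul, inv_mul_cancel₀ hx.ne']; simp
      have h2 : (starRingEnd ℂ) z * ((exp (H z) * (1 + z * deriv H z))⁻¹ * -F z₀) =
          ((-((1 - x)⁻¹ * normSq z) : ℝ) : ℂ) * (1 + z * deriv H z)⁻¹ := by
        rw [hFz0, mul_inv]
        push_cast
        rw [normSq_eq_conj_mul_self]
        field_simp [exp_ne_zero]
      rw [h2, re_ofReal_mul, inv_re]
      have h3 := hpos z hz1
      have h4 : 0 < normSq (1 + z * deriv H z) :=
        normSq_pos.2 (fun h => by rw [h] at h3; simp at h3)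
      have h5 := normSq_pos.2 hzne
      have h6 := inv_pos.2 hx
      have := mul_pos (mul_pos h6 h5) (div_pos h3 h4)
      linarith)
    have himg : ∀ᶠ s in 𝓝[>] x, (1 - s) • F z₀ ∈ F '' ball 0 1 :=
      nhdsWithin_le_nhds (hpath.continuousAt.eventually
        (hopen.mem_nhds (by simp only [← hzx]; exact mem_image_of_mem F hz1)))
    filter_upwards [hlt, himg] with s hs1 hs2
    obtain ⟨w, hw, hws⟩ := hs2
    refine ⟨w, ?_, hws⟩
    rw [← hws, hGF hw, hG0] at hs1
    rw [mem_closedBall_zero_iff] at hz ⊢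
    exact hs1.le.trans hz
  obtain ⟨z, hz, hza⟩ := hsub2 (show (1 - a) ∈ Icc (0 : ℝ) 1 from ⟨by linarith, by linarith⟩)
  exact ⟨z, hsub hz, by rw [hza]; simp⟩

/-! ### Sufficiency for convex functions -/

theorem exists_eq_mul_exp_of_norm_eq {z ζ : ℂ} (h : ‖ζ‖ = ‖z‖) (hne : ζ ≠ z) :
    ∃ θ ∈ Ioo (0 : ℝ) (2 * Real.pi), ζ = z * exp (θ * I) := by
  have hz : z ≠ 0 := by
    rintro rfl
    exact hne (by simpa using h)
  have h1 : ‖ζ / z‖ = 1 := by rw [norm_div, h, div_self (norm_ne_zero_iff.2 hz)]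
  have h2 : ζ = z * exp (arg (ζ / z) * I) := by
    have := norm_mul_exp_arg_mul_I (ζ / z)
    rw [h1, ofReal_one, one_mul] at this
    rw [this]; field_simp
  have h3 := arg_le_pi (ζ / z)
  have h4 := neg_pi_lt_arg (ζ / z)
  have h6 := Real.pi_pos
  rcases lt_trichotomy (arg (ζ / z)) 0 with h5 | h5 | h5
  · refine ⟨arg (ζ / z) + 2 * Real.pi, ⟨by linarith, by linarith⟩, ?_⟩
    push_cast
    rw [add_mul, exp_add, exp_two_pi_mul_I, mul_one]
    exact h2
  · rw [h5] at h2
    simp at h2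
    exact absurd h2 hne
  · exact ⟨_, ⟨h5, by linarith⟩, h2⟩

/-- The image of a circle lies on one side of each of its tangent lines. -/
theorem re_sub_div_pos_of_circle {F H : ℂ → ℂ} (hH : DifferentiableOn ℂ H (ball 0 1))
    (hF : ∀ z ∈ ball (0 : ℂ) 1, HasDerivAt F (exp (H z)) z)
    (hpos : ∀ z ∈ ball (0 : ℂ) 1, 0 < (1 + z * deriv H z).re) {z : ℂ}
    (hz : z ∈ ball (0 : ℂ) 1) (hz0 : z ≠ 0) {θ : ℝ} (hθ : θ ∈ Ioo (0 : ℝ) (2 * Real.pi)) :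
    0 < ((F z - F (z * exp (θ * I))) / (z * exp (H z))).re := by
  have hmem : ∀ θ : ℝ, z * exp (θ * I) ∈ ball (0 : ℂ) 1 := fun θ => by
    rw [mem_ball_zero_iff, norm_mul, norm_exp_ofReal_mul_I, mul_one]
    exact mem_ball_zero_iff.1 hz
  have hc : ∀ θ : ℝ, HasDerivAt (fun w : ℂ => z * exp (w * I)) (z * exp (θ * I) * I) (θ : ℂ) :=
    fun θ => (((hasDerivAt_id (θ : ℂ)).mul_const I).cexp.const_mul z).congr_deriv
      (by simp only [id]; ring)
  -- `ψ` is the angle through which the tangent of the image circle has turned since `F z`; its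
  -- derivative is `Re (1 + w H' w)` at `w = z exp (iθ)`, and it increases from `0` to `2π`.
  set ψ : ℝ → ℝ := fun θ => θ + (H (z * exp (θ * I)) - H z).im with hψ
  have hψd : ∀ θ : ℝ, HasDerivAt ψ
      (1 + z * exp (θ * I) * deriv H (z * exp (θ * I))).re θ := fun θ => by
    have h1 := (((hH.differentiableAt (isOpen_ball.mem_nhds (hmem θ))).hasDerivAt).comp (θ : ℂ)
      (hc θ)).sub_const (H z)
    have h2 := (h1.mul_const (-I)).real_of_complex
    refine ((hasDerivAt_id θ).add (h2.congr_of_eventuallyEq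
      (Eventually.of_forall fun t => ?_))).congr_deriv ?_
    · simp
    · have : deriv H (z * exp (θ * I)) * (z * exp (θ * I) * I) * -I =
          z * exp (θ * I) * deriv H (z * exp (θ * I)) := by
        linear_combination (-(deriv H (z * exp (θ * I)) * (z * exp (θ * I)))) * I_mul_I
      rw [this]; simp
  have hψmono : StrictMono ψ := strictMono_of_deriv_pos fun θ => by
    rw [(hψd θ).deriv]; exact hpos _ (hmem θ)
  have hψ0 : ψ 0 = 0 := by simp [hψ]
  have hψ2 : ψ (2 * Real.pi) = 2 * Real.pi := by simp [hψ, exp_two_pi_mul_I]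
  have hπ := Real.pi_pos
  obtain ⟨c, hc01, hcπ⟩ : Real.pi ∈ ψ '' Icc (0 : ℝ) (2 * Real.pi) :=
    intermediate_value_Icc (by linarith)
      (fun θ _ => (hψd θ).continuousAt.continuousWithinAt)
      ⟨by rw [hψ0]; linarith, by rw [hψ2]; linarith⟩
  -- `u` is the distance to the tangent line at `F z`, up to a positive factor. Its derivative has
  -- the sign of `sin ψ`, so `u` rises from `0` until `ψ = π` and then falls back to `0`.
  set u : ℝ → ℝ := fun θ => ((F z - F (z * exp (θ * I))) / (z * exp (H z))).re with hu
  have hud : ∀ θ : ℝ, HasDerivAt u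
      (Real.exp (H (z * exp (θ * I)) - H z).re * Real.sin (ψ θ)) θ := fun θ => by
    have h1 := ((((hF _ (hmem θ)).comp (θ : ℂ) (hc θ)).const_sub (F z)).div_const
      (z * exp (H z))).real_of_complex
    refine h1.congr_deriv ?_
    have h2 : -(exp (H (z * exp (θ * I))) * (z * exp (θ * I) * I)) / (z * exp (H z)) =
        -(exp (θ * I + (H (z * exp (θ * I)) - H z)) * I) := by
      rw [exp_add, exp_sub]
      field_simp [exp_ne_zero]
    rw [h2]
    simp [exp_im, hψ]
  have hu0 : u 0 = 0 := by simp [hu]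
  have hu2 : u (2 * Real.pi) = 0 := by simp [hu, exp_two_pi_mul_I]
  rcases le_total θ c with h | h
  · have hm : StrictMonoOn u (Icc 0 c) := strictMonoOn_of_deriv_pos (convex_Icc _ _)
      (fun θ _ => (hud θ).continuousAt.continuousWithinAt) fun x hx => by
        rw [interior_Icc] at hx
        rw [(hud x).deriv]
        refine mul_pos (Real.exp_pos _) (Real.sin_pos_of_pos_of_lt_pi ?_ ?_)
        · rw [← hψ0]; exact hψmono hx.1
        · rw [← hcπ]; exact hψmono hx.2
    have := hm (left_mem_Icc.2 hc01.1) ⟨hθ.1.le, h⟩ hθ.1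
    rwa [hu0] at this
  · have hm : StrictAntiOn u (Icc c (2 * Real.pi)) := strictAntiOn_of_deriv_neg (convex_Icc _ _)
      (fun θ _ => (hud θ).continuousAt.continuousWithinAt) fun x hx => by
        rw [interior_Icc] at hx
        rw [(hud x).deriv]
        refine mul_neg_of_pos_of_neg (Real.exp_pos _) ?_
        have h1 : Real.pi < ψ x := by rw [← hcπ]; exact hψmono hx.1
        have h2 : ψ x < 2 * Real.pi := by
          have := hψmono hx.2
          rwa [hψ2] at this
        have := Real.sin_pos_of_pos_of_lt_pi (sub_pos.2 h1) (by linarith)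
        rw [Real.sin_sub_pi] at this
        linarith
    have := hm ⟨h, hθ.2.le⟩ (right_mem_Icc.2 hc01.2) hθ.2
    rwa [hu2] at this

/-- The circle estimate bounds `|exp (-(F z - F ζ) / (z exp (H z)))|` by `1` on the circle, hence
inside by the maximum principle. Equality inside would make this function constant, although its
derivative never vanishes. -/
theorem re_sub_div_pos_of_disc {F H : ℂ → ℂ} (hH : DifferentiableOn ℂ H (ball 0 1))
    (hF : ∀ z ∈ ball (0 : ℂ) 1, HasDerivAt F (exp (H z)) z)
    (hpos : ∀ z ∈ ball (0 : ℂ) 1, 0 < (1 + z * deriv H z).re) {z ζ : ℂ}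
    (hz : z ∈ ball (0 : ℂ) 1) (hζ : ‖ζ‖ < ‖z‖) :
    0 < ((F z - F ζ) / (z * exp (H z))).re := by
  have hz0 : z ≠ 0 := by
    rintro rfl
    simp only [norm_zero] at hζ
    exact absurd (norm_nonneg ζ) (not_le.2 hζ)
  have hsub : closedBall (0 : ℂ) ‖z‖ ⊆ ball 0 1 :=
    closedBall_subset_ball (mem_ball_zero_iff.1 hz)
  set E : ℂ → ℂ := fun ζ => exp (-((F z - F ζ) / (z * exp (H z)))) with hE
  have hEd : ∀ w ∈ ball (0 : ℂ) 1,
      HasDerivAt E (E w * (exp (H w) / (z * exp (H z)))) w := fun w hw =>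
    ((((hF w hw).const_sub (F z)).div_const (z * exp (H z))).neg.cexp).congr_deriv (by
      simp only [hE, Pi.neg_apply]; ring)
  have hn : ∀ w, ‖E w‖ = Real.exp (-((F z - F w) / (z * exp (H z))).re) := fun w => by
    simp only [hE, norm_exp, neg_re]
  have hcl : DiffContOnCl ℂ E (ball 0 ‖z‖) := by
    refine DifferentiableOn.diffContOnCl fun w hw => ?_
    exact (hEd w (hsub (closure_ball_subset_closedBall hw))).differentiableAt.differentiableWithinAt
  have hle : ∀ w ∈ ball (0 : ℂ) ‖z‖, ‖E w‖ ≤ 1 := fun w hw => by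
    refine norm_le_of_forall_mem_frontier_norm_le isBounded_ball hcl (fun y hy => ?_)
      (subset_closure hw)
    rw [frontier_ball _ (norm_ne_zero_iff.2 hz0), mem_sphere_zero_iff_norm] at hy
    rw [hn, Real.exp_le_one_iff, neg_nonpos]
    rcases eq_or_ne y z with rfl | hyz
    · simp
    obtain ⟨θ, hθ, rfl⟩ := exists_eq_mul_exp_of_norm_eq hy hyz
    exact (re_sub_div_pos_of_circle hH hF hpos hz hz0 hθ).le
  by_contra! hcon
  have hζm : ζ ∈ ball (0 : ℂ) ‖z‖ := mem_ball_zero_iff.2 hζ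
  have hmax : IsMaxOn (norm ∘ E) (ball 0 ‖z‖) ζ := fun w hw => by
    refine (hle w hw).trans ?_
    rw [Function.comp_apply, hn]
    exact Real.one_le_exp (by linarith)
  have hconst := eqOn_of_isPreconnected_of_isMaxOn_norm (convex_ball (0 : ℂ) ‖z‖).isPreconnected
    isOpen_ball hcl.differentiableOn hζm hmax
  have hd0 : HasDerivAt E 0 ζ := (hasDerivAt_const ζ (E ζ)).congr_of_eventuallyEq (by
    filter_upwards [isOpen_ball.mem_nhds hζm] with w hw using hconst hw)
  have := hd0.unique (hEd ζ (hsub (ball_subset_closedBall hζm)))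
  exact (mul_ne_zero (exp_ne_zero _)
    (div_ne_zero (exp_ne_zero _) (mul_ne_zero hz0 (exp_ne_zero _)))) this.symm

theorem injOn_of_convexity {F H : ℂ → ℂ} (hH : DifferentiableOn ℂ H (ball 0 1))
    (hF : ∀ z ∈ ball (0 : ℂ) 1, HasDerivAt F (exp (H z)) z)
    (hpos : ∀ z ∈ ball (0 : ℂ) 1, 0 < (1 + z * deriv H z).re) : InjOn F (ball 0 1) := by
  -- Equal values at `z` and `ζ` would make the strictly positive real part of the circle or disc
  -- estimate equal to `0`.
  have key : ∀ z ∈ ball (0 : ℂ) 1, ∀ ζ, ‖ζ‖ ≤ ‖z‖ → F z = F ζ → ζ = z := fun z hz ζ h he => by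
    rcases h.lt_or_eq with h | h
    · have := re_sub_div_pos_of_disc hH hF hpos hz h
      rw [he] at this
      simp at this
    · by_contra hne
      have hz0 : z ≠ 0 := by
        rintro rfl
        exact hne (by simpa using h)
      obtain ⟨θ, hθ, rfl⟩ := exists_eq_mul_exp_of_norm_eq h hne
      have := re_sub_div_pos_of_circle hH hF hpos hz hz0 hθ
      rw [he] at this
      simp at this
  intro z hz ζ hζ h
  rcases le_total ‖ζ‖ ‖z‖ with h1 | h1
  · exact (key z hz ζ h1 h).symm
  · exact key ζ hζ z h1 h.symm

theorem convex_image_of_convexity {F H : ℂ → ℂ} (hH : DifferentiableOn ℂ H (ball 0 1))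
    (hF : ∀ z ∈ ball (0 : ℂ) 1, HasDerivAt F (exp (H z)) z)
    (hpos : ∀ z ∈ ball (0 : ℂ) 1, 0 < (1 + z * deriv H z).re) :
    Convex ℝ (F '' ball 0 1) := by
  have hinj := injOn_of_convexity hH hF hpos
  have hFd : DifferentiableOn ℂ F (ball 0 1) := fun z hz =>
    (hF z hz).differentiableAt.differentiableWithinAt
  rw [convex_iff_segment_subset]
  rintro _ ⟨z₁, h₁, rfl⟩ _ ⟨z₂, h₂, rfl⟩
  obtain ⟨R, hR, hR1⟩ := exists_between
    (max_lt (mem_ball_zero_iff.1 h₁) (mem_ball_zero_iff.1 h₂))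
  obtain ⟨hR2, hR3⟩ := max_lt_iff.1 hR
  have hsub : closedBall (0 : ℂ) R ⊆ ball 0 1 := closedBall_subset_ball hR1
  have hopen := (exists_inverse_of_injOn isOpen_ball
    (hFd.mono (ball_subset_closedBall.trans hsub))
    (hinj.mono (ball_subset_closedBall.trans hsub))).1
  set p : ℝ → ℂ := fun t => F z₁ + t • (F z₂ - F z₁) with hp
  have hpc : Continuous p := by fun_prop
  have hclosed : IsClosed (p ⁻¹' (F '' closedBall 0 R)) :=
    (((isCompact_closedBall (0 : ℂ) R).image_of_continuousOn
      (hFd.continuousOn.mono hsub)).isClosed).preimage hpc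
  -- Continuous induction along the segment: the image of the closed disc of radius `R` is closed,
  -- and the image of the open disc is open.
  have hIcc : Icc (0 : ℝ) 1 ⊆ p ⁻¹' (F '' closedBall 0 R) := by
    refine IsClosed.Icc_subset_of_forall_mem_nhdsWithin (hclosed.inter isClosed_Icc)
      ⟨z₁, by rw [mem_closedBall_zero_iff]; exact hR2.le, by simp [hp]⟩ ?_
    rintro t ⟨⟨z, hz, hzt⟩, ht0, ht1⟩
    -- If `‖z‖ = R`, both endpoints lie strictly on one side of the tangent line at `F z`, so `F z`
    -- cannot be a convex combination of them.
    have hzlt : ‖z‖ < R := by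
      refine lt_of_le_of_ne (mem_closedBall_zero_iff.1 hz) fun hzR => ?_
      have e1 := re_sub_div_pos_of_disc hH hF hpos (hsub hz) (hR2.trans_eq hzR.symm)
      have e2 := re_sub_div_pos_of_disc hH hF hpos (hsub hz) (hR3.trans_eq hzR.symm)
      have e3 : ((1 - t : ℝ) : ℂ) * ((F z - F z₁) / (z * exp (H z))) +
          (t : ℂ) * ((F z - F z₂) / (z * exp (H z))) = 0 := by
        rw [hzt, hp]
        simp only [real_smul]
        push_cast
        ring
      have e4 := congrArg re e3
      rw [add_re, re_ofReal_mul, re_ofReal_mul, zero_re] at e4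
      have e5 := mul_pos (sub_pos.2 ht1) e1
      have e6 := mul_nonneg ht0 e2.le
      linarith
    refine nhdsWithin_le_nhds (mem_of_superset (hpc.continuousAt.preimage_mem_nhds
      (hopen.mem_nhds ?_)) (preimage_mono (image_mono ball_subset_closedBall)))
    rw [← hzt]
    exact mem_image_of_mem F (mem_ball_zero_iff.2 hzlt)
  rw [segment_eq_image']
  rintro _ ⟨t, ht, rfl⟩
  exact image_mono hsub (hIcc ht)

/-! ### Necessity, by Schwarz's lemma -/

theorem exists_exp_of_ne_zero {g : ℂ → ℂ} (hg : DifferentiableOn ℂ g (ball 0 1))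
    (hg0 : g 0 = 1) (hne : ∀ z ∈ ball (0 : ℂ) 1, g z ≠ 0) :
    ∃ H : ℂ → ℂ, DifferentiableOn ℂ H (ball 0 1) ∧ ∀ z ∈ ball (0 : ℂ) 1, g z = exp (H z) := by
  obtain ⟨H, h1, -, h2, -⟩ := exists_exp_of_mul_deriv (P := fun z => 1 + z * (deriv g z / g z)) hg
    ((differentiableOn_const 1).add
      (differentiableOn_id.mul ((hg.deriv isOpen_ball).div hg hne))) hg0 (by simp)
    (fun z _ hz => by field_simp; ring)
  exact ⟨H, h1, h2⟩

/-- The maximum principle for `exp (-Q)`: where `Re Q ≤ 0` its modulus would be maximal, hence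
constant, but at the origin it is `exp (-1)`. -/
theorem re_pos_of_re_nonneg {Q : ℂ → ℂ} (hQ : DifferentiableOn ℂ Q (ball 0 1)) (h0 : Q 0 = 1)
    (h : ∀ z ∈ ball (0 : ℂ) 1, 0 ≤ (Q z).re) : ∀ z ∈ ball (0 : ℂ) 1, 0 < (Q z).re := by
  intro z hz
  by_contra! hcon
  have hmax : IsMaxOn (norm ∘ fun w => exp (-Q w)) (ball 0 1) z := fun w hw => by
    simp only [Function.comp_apply, norm_exp, neg_re, mem_ofPred_eq]
    exact Real.exp_le_exp.2 (by linarith [h w hw])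
  have := norm_eqOn_of_isPreconnected_of_isMaxOn (convex_ball (0 : ℂ) 1).isPreconnected
    isOpen_ball hQ.neg.cexp hz hmax (mem_ball_self one_pos)
  simp only [Function.comp_apply, norm_exp, Pi.neg_apply, neg_re, h0, one_re, Function.const_apply,
    Real.exp_eq_exp] at this
  linarith

/-- The subordination principle: `G ∘ K` maps the disc to itself and fixes `0`, so Schwarz's lemma
applies. -/
theorem norm_comp_inverse_le {F G K : ℂ → ℂ} (hGF : LeftInvOn G F (ball 0 1))
    (hG : ∀ z ∈ ball (0 : ℂ) 1, DifferentiableAt ℂ G (F z))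
    (hK : DifferentiableOn ℂ K (ball 0 1)) (hm : MapsTo K (ball 0 1) (F '' ball 0 1))
    (hK0 : K 0 = F 0) {z : ℂ} (hz : z ∈ ball (0 : ℂ) 1) : ‖G (K z)‖ ≤ ‖z‖ := by
  have h0 : (0 : ℂ) ∈ ball (0 : ℂ) 1 := mem_ball_self one_pos
  refine norm_le_norm_of_mapsTo_ball (f := fun z => G (K z)) (R := 1) ?_ ?_ ?_
    (mem_ball_zero_iff.1 hz)
  · intro w hw
    obtain ⟨y, hy, hyw⟩ := hm hw
    have := hG y hy
    rw [hyw] at this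
    exact (this.comp w (hK.differentiableAt (isOpen_ball.mem_nhds hw))).differentiableWithinAt
  · intro w hw
    obtain ⟨y, hy, hyw⟩ := hm hw
    simp only [← hyw, hGF hy]
    exact ball_subset_closedBall hy
  · simp only [hK0, hGF h0]

theorem re_inv_nonneg {w : ℂ} (h : 0 ≤ (w⁻¹).re) : 0 ≤ w.re := by
  rcases eq_or_ne w 0 with rfl | hw
  · simp
  rw [inv_re] at h
  by_contra! hc
  exact absurd h (not_le.2 (div_neg_of_neg_of_pos hc (normSq_pos.2 hw)))

/-- Each `(1 - s) F` is subordinate to `F`, so `|G ((1 - s) F z)| ≤ |z|` with equality at `s = 0`.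
Differentiating there gives `Re (F / (z F')) ≥ 0`, and inversion preserves this sign. -/
theorem exists_exp_of_starConvex {F : ℂ → ℂ} (hF : DifferentiableOn ℂ F (ball 0 1))
    (hinj : InjOn F (ball 0 1)) (hF0 : F 0 = 0) (hF1 : deriv F 0 = 1)
    (hs : StarConvex ℝ 0 (F '' ball 0 1)) :
    ∃ H : ℂ → ℂ, DifferentiableOn ℂ H (ball 0 1) ∧
      (∀ z ∈ ball (0 : ℂ) 1, F z = z * exp (H z)) ∧
      ∀ z ∈ ball (0 : ℂ) 1, 0 < (1 + z * deriv H z).re := by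
  have h0 : (0 : ℂ) ∈ ball (0 : ℂ) 1 := mem_ball_self one_pos
  obtain ⟨-, hne, G, hGF, hG⟩ := exists_inverse_of_injOn isOpen_ball hF hinj
  have hFg : ∀ z, F z = z * dslope F 0 z := fun z => by
    have := sub_smul_dslope F 0 z
    simp only [sub_zero, smul_eq_mul, hF0] at this
    exact this.symm
  obtain ⟨H, hH, hHe⟩ := exists_exp_of_ne_zero (g := dslope F 0)
    ((differentiableOn_dslope (isOpen_ball.mem_nhds h0)).2 hF) (by rw [dslope_same, hF1])
    (fun z hz hzero => by
      rcases eq_or_ne z 0 with rfl | hz0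
      · rw [dslope_same, hF1] at hzero; exact one_ne_zero hzero
      · refine hz0 (hinj hz h0 ?_)
        rw [hFg z, hzero, mul_zero, hF0])
  have hFe : ∀ z ∈ ball (0 : ℂ) 1, F z = z * exp (H z) := fun z hz => by rw [hFg z, hHe z hz]
  refine ⟨H, hH, hFe, re_pos_of_re_nonneg ((differentiableOn_const 1).add
    (differentiableOn_id.mul (hH.deriv isOpen_ball))) (by simp) fun z hz => ?_⟩
  rcases eq_or_ne z 0 with rfl | hz0
  · simp
  have hd : deriv F z = exp (H z) * (1 + z * deriv H z) :=
    ((hasDerivAt_id_mul_exp hH hz).congr_of_eventuallyEq (by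
      filter_upwards [isOpen_ball.mem_nhds hz] with w hw using hFe w hw)).deriv
  have hpath : HasDerivAt (fun s : ℝ => (1 - s) • F z) (-F z) 0 := by
    simpa using (((hasDerivAt_id (0 : ℝ)).const_sub 1).smul_const (F z))
  have hγ : HasDerivAt (fun s : ℝ => G ((1 - s) • F z)) ((deriv F z)⁻¹ * -F z) 0 :=
    (hG z hz).comp_of_eq (0 : ℝ) hpath (by simp)
  have hγ0 : G ((1 - (0 : ℝ)) • F z) = z := by
    rw [sub_zero, one_smul, hGF hz]
  have := re_nonpos_of_norm_le hγ.hasDerivWithinAt (by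
    have h1 : Ioo (0 : ℝ) 1 ∈ 𝓝[>] (0 : ℝ) := Ioo_mem_nhdsGT one_pos
    filter_upwards [h1] with s hs'
    rw [hγ0]
    refine norm_comp_inverse_le (K := fun w => (1 - s) • F w) hGF
      (fun w hw => (hG w hw).differentiableAt) (by fun_prop) (fun w hw => ?_) (by simp [hF0]) hz
    exact (starConvex_zero_iff.1 hs) (mem_image_of_mem F hw) (by linarith [hs'.2])
      (by linarith [hs'.1]))
  rw [hγ0, hd, hFe z hz] at this
  have h2 : (starRingEnd ℂ) z * ((exp (H z) * (1 + z * deriv H z))⁻¹ * -(z * exp (H z))) =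
      ((-normSq z : ℝ) : ℂ) * (1 + z * deriv H z)⁻¹ := by
    rw [mul_inv]
    push_cast
    rw [normSq_eq_conj_mul_self]
    field_simp [exp_ne_zero]
  rw [h2, re_ofReal_mul] at this
  refine re_inv_nonneg ?_
  have h5 := normSq_pos.2 hz0
  by_contra! hc
  nlinarith [mul_pos h5 (neg_pos.2 hc)]

/-- Since `φ' 0 = 0`, the expansion of `φ` starts at second order, and the substitution `θ = √s`
turns that term into a first-order one, with coefficient `φ'' 0 / 2`. -/
theorem hasDerivWithinAt_comp_sqrt {φ ψ : ℝ → ℂ} {c : ℂ} (hφ : ∀ θ, HasDerivAt φ (ψ θ) θ)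
    (hψ0 : ψ 0 = 0) (hψ : HasDerivAt ψ c 0) :
    HasDerivWithinAt (fun s => φ (Real.sqrt s)) ((1 / 2 : ℂ) * c) (Ici 0) 0 := by
  have hd : ∀ s : ℝ, 0 < s → HasDerivAt (fun s => φ (Real.sqrt s))
      ((1 / (2 * Real.sqrt s)) • ψ (Real.sqrt s)) s := fun s hs =>
    (hφ (Real.sqrt s)).scomp s (Real.hasDerivAt_sqrt hs.ne')
  refine hasDerivWithinAt_Ici_of_tendsto_deriv (s := Ioi 0)
    (fun s hs => (hd s hs).differentiableAt.differentiableWithinAt) ?_ self_mem_nhdsWithin ?_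
  · exact ((hφ (Real.sqrt 0)).continuousAt.comp
      (f := Real.sqrt) Real.continuous_sqrt.continuousAt).continuousWithinAt
  · have h1 : Tendsto (fun s : ℝ => Real.sqrt s) (𝓝[>] 0) (𝓝[≠] 0) := by
      refine tendsto_nhdsWithin_iff.2 ⟨?_, ?_⟩
      · have := Real.continuous_sqrt.tendsto 0
        rw [Real.sqrt_zero] at this
        exact this.mono_left nhdsWithin_le_nhds
      · filter_upwards [self_mem_nhdsWithin] with s hs using (Real.sqrt_pos.2 hs).ne'
    have h2 := ((hasDerivAt_iff_tendsto_slope.1 hψ).comp h1).const_mul (1 / 2 : ℂ)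
    refine h2.congr' ?_
    filter_upwards [self_mem_nhdsWithin] with s hs
    rw [(hd s hs).deriv, Function.comp_apply, slope_def_module, hψ0]
    simp only [sub_zero, real_smul]
    push_cast
    ring

/-- By convexity the mean of `F (z exp (iθ))` and `F (z exp (-iθ))` is subordinate to `F`. Being
even in `θ`, it differs from `F z` at second order, by `-(θ²/2) z F' (1 + z H')`. With `θ = √s` this
is a velocity, and Schwarz's lemma says that the pulled-back curve does not move outwards. -/
theorem exists_exp_of_convex {F : ℂ → ℂ} (hF : DifferentiableOn ℂ F (ball 0 1))
    (hinj : InjOn F (ball 0 1)) (hF1 : deriv F 0 = 1) (hc : Convex ℝ (F '' ball 0 1)) :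
    ∃ H : ℂ → ℂ, DifferentiableOn ℂ H (ball 0 1) ∧
      (∀ z ∈ ball (0 : ℂ) 1, HasDerivAt F (exp (H z)) z) ∧
      ∀ z ∈ ball (0 : ℂ) 1, 0 < (1 + z * deriv H z).re := by
  obtain ⟨-, hne, G, hGF, hG⟩ := exists_inverse_of_injOn isOpen_ball hF hinj
  obtain ⟨H, hH, hHe⟩ := exists_exp_of_ne_zero (hF.deriv isOpen_ball) hF1 hne
  have hFe : ∀ z ∈ ball (0 : ℂ) 1, HasDerivAt F (exp (H z)) z := fun z hz => by
    rw [← hHe z hz]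
    exact (hF.differentiableAt (isOpen_ball.mem_nhds hz)).hasDerivAt
  refine ⟨H, hH, hFe, re_pos_of_re_nonneg ((differentiableOn_const 1).add
    (differentiableOn_id.mul (hH.deriv isOpen_ball))) (by simp) fun z hz => ?_⟩
  rcases eq_or_ne z 0 with rfl | hz0
  · simp
  have hrot : ∀ (θ : ℝ) (w : ℂ), w ∈ ball (0 : ℂ) 1 → w * exp (θ * I) ∈ ball (0 : ℂ) 1 :=
    fun θ w hw => by
      rw [mem_ball_zero_iff, norm_mul, norm_exp_ofReal_mul_I, mul_one]
      exact mem_ball_zero_iff.1 hw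
  have he : ∀ θ : ℝ, HasDerivAt (fun t : ℝ => z * exp (t * I)) (z * exp (θ * I) * I) θ :=
    fun θ => ((((hasDerivAt_id (θ : ℂ)).mul_const I).cexp.const_mul z).congr_deriv
      (by simp only [id]; ring)).comp_ofReal
  set k : ℝ → ℂ := fun θ => F (z * exp (θ * I)) with hk
  set k' : ℝ → ℂ := fun θ => exp (H (z * exp (θ * I))) * (z * exp (θ * I) * I) with hk'
  have hkd : ∀ θ, HasDerivAt k (k' θ) θ := fun θ =>
    (hFe _ (hrot θ z hz)).comp_of_eq θ (he θ) rfl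
  have hkd2 : HasDerivAt k' (-(exp (H z) * z * (1 + z * deriv H z))) 0 := by
    have h1 := ((hH.differentiableAt (isOpen_ball.mem_nhds (hrot 0 z hz))).hasDerivAt.cexp).comp_of_eq
      (0 : ℝ) (he 0) rfl
    refine (h1.mul ((he 0).mul_const I)).congr_deriv ?_
    simp only [ofReal_zero, zero_mul, exp_zero, mul_one, Function.comp_apply]
    linear_combination (exp (H z) * z * (1 + z * deriv H z)) * I_mul_I
  have hneg : ∀ θ : ℝ, HasDerivAt (fun θ : ℝ => -θ) (-1) θ := fun θ => hasDerivAt_neg θ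
  have hφ : ∀ θ, HasDerivAt (fun θ => (1 / 2 : ℂ) * (k θ + k (-θ)))
      ((1 / 2 : ℂ) * (k' θ - k' (-θ))) θ := fun θ =>
    (((hkd θ).add ((hkd (-θ)).scomp θ (hneg θ))).const_mul _).congr_deriv (by simp; ring)
  have hψ : HasDerivAt (fun θ => (1 / 2 : ℂ) * (k' θ - k' (-θ)))
      (-(exp (H z) * z * (1 + z * deriv H z))) 0 := by
    have h1 : HasDerivAt (fun θ => k' (-θ)) ((-1 : ℝ) • -(exp (H z) * z * (1 + z * deriv H z))) 0 :=
      HasDerivAt.scomp_of_eq (0 : ℝ) hkd2 (hneg 0) (by simp)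
    exact ((hkd2.sub h1).const_mul (1 / 2 : ℂ)).congr_deriv (by simp; ring)
  have hpath := hasDerivWithinAt_comp_sqrt hφ (by simp) hψ
  have hγ := (hG z hz).comp_hasDerivWithinAt_of_eq (0 : ℝ) hpath (by simp [hk]; ring)
  have hγ0 : (G ∘ fun s => (1 / 2 : ℂ) * (k (Real.sqrt s) + k (-Real.sqrt s))) 0 = z := by
    have : (1 / 2 : ℂ) * (F z + F z) = F z := by ring
    simp [hk] at this ⊢
    rw [this, hGF hz]
  have := re_nonpos_of_norm_le hγ (Eventually.of_forall fun s => by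
    rw [hγ0]
    refine norm_comp_inverse_le (K := fun w => (1 / 2 : ℂ) * (F (w * exp ((Real.sqrt s : ℝ) * I)) +
      F (w * exp ((-Real.sqrt s : ℝ) * I)))) hGF (fun w hw => (hG w hw).differentiableAt)
      ?_ (fun w hw => ?_) (by simp; ring) hz
    · refine DifferentiableOn.const_mul ?_ _
      exact (hF.comp (differentiableOn_id.mul_const _) (fun w hw => hrot _ w hw)).add
        (hF.comp (differentiableOn_id.mul_const _) (fun w hw => hrot _ w hw))
    · have := hc (mem_image_of_mem F (hrot (Real.sqrt s) w hw))
        (mem_image_of_mem F (hrot (-Real.sqrt s) w hw)) (a := 1 / 2) (b := 1 / 2)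
        (by norm_num) (by norm_num) (by norm_num)
      simp only [real_smul] at this
      push_cast at this ⊢
      rwa [mul_add])
  rw [hγ0, ← hHe z hz |>.symm] at this
  have h2 : (starRingEnd ℂ) z * ((exp (H z))⁻¹ * ((1 / 2 : ℂ) *
      -(exp (H z) * z * (1 + z * deriv H z)))) =
      ((-(normSq z / 2) : ℝ) : ℂ) * (1 + z * deriv H z) := by
    push_cast
    rw [normSq_eq_conj_mul_self]
    field_simp [exp_ne_zero]
  rw [h2, re_ofReal_mul] at this
  have h5 := normSq_pos.2 hz0
  by_contra! hc
  nlinarith [mul_pos h5 (neg_pos.2 hc)]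

/-! ### Power series and Carathéodory's bound -/

/-- The generality serves two cases: complex series on the disc, and series with real coefficients
on the quaternionic ball. -/
theorem hasFPowerSeriesOnBall_ofScalars {𝕜 E : Type*} [NontriviallyNormedField 𝕜] [NormedRing E]
    [NormOneClass E] [NormedAlgebra 𝕜 E] {c : ℕ → 𝕜} {f : E → E}
    (hc : ∀ r : NNReal, r < 1 → Summable fun n => ‖c n‖ * (r : ℝ) ^ n)
    (hf : ∀ x ∈ ball (0 : E) 1, HasSum (fun n => c n • x ^ n) (f x)) :
    HasFPowerSeriesOnBall f (FormalMultilinearSeries.ofScalars E c) 0 1 where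
  r_le := by
    refine ENNReal.le_of_forall_nnreal_lt fun r hr => ?_
    refine FormalMultilinearSeries.le_radius_of_summable _ ?_
    simpa using hc r (by exact_mod_cast hr)
  r_pos := one_pos
  hasSum := fun {y} hy => by
    simp only [FormalMultilinearSeries.ofScalars_apply_eq, zero_add]
    exact hf y (by simpa [enorm, edist_zero_right, ← NNReal.coe_lt_one] using hy)

theorem summable_norm_mul_pow_of_hasSum {c : ℕ → ℂ} {f : ℂ → ℂ}
    (hf : ∀ z ∈ ball (0 : ℂ) 1, HasSum (fun n => c n * z ^ n) (f z)) {r : ℝ} (hr0 : 0 ≤ r)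
    (hr : r < 1) : Summable fun n => ‖c n‖ * r ^ n := by
  have := (hf (r : ℂ) (by simpa [abs_of_nonneg hr0] using hr)).summable.norm
  simpa [abs_of_nonneg hr0] using this

theorem hasFPowerSeriesOnBall_of_hasSum {c : ℕ → ℂ} {f : ℂ → ℂ}
    (hf : ∀ z ∈ ball (0 : ℂ) 1, HasSum (fun n => c n * z ^ n) (f z)) :
    HasFPowerSeriesOnBall f (FormalMultilinearSeries.ofScalars ℂ c) 0 1 :=
  hasFPowerSeriesOnBall_ofScalars
    (fun r hr => summable_norm_mul_pow_of_hasSum hf r.2 (by exact_mod_cast hr)) hf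

theorem coeff_unique {c d : ℕ → ℂ} {f g : ℂ → ℂ}
    (hf : ∀ z ∈ ball (0 : ℂ) 1, HasSum (fun n => c n * z ^ n) (f z))
    (hg : ∀ z ∈ ball (0 : ℂ) 1, HasSum (fun n => d n * z ^ n) (g z))
    (hfg : ∀ z ∈ ball (0 : ℂ) 1, f z = g z) : c = d := by
  have h1 := (hasFPowerSeriesOnBall_of_hasSum hf).hasFPowerSeriesAt
  have h2 := (hasFPowerSeriesOnBall_of_hasSum hg).hasFPowerSeriesAt
  have h3 := h1.eq_formalMultilinearSeries_of_eventually h2 (by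
    filter_upwards [ball_mem_nhds (0 : ℂ) one_pos] with z hz using hfg z hz)
  exact FormalMultilinearSeries.ofScalars_series_injective ℂ ℂ h3

/-- The Taylor coefficients of `f` at the origin. -/
noncomputable def taylorCoeff (f : ℂ → ℂ) (n : ℕ) : ℂ := (n.factorial : ℂ)⁻¹ * iteratedDeriv n f 0

theorem hasSum_taylorCoeff {f : ℂ → ℂ} (hf : DifferentiableOn ℂ f (ball 0 1)) {z : ℂ}
    (hz : z ∈ ball (0 : ℂ) 1) : HasSum (fun n => taylorCoeff f n * z ^ n) (f z) := by
  have := hasSum_taylorSeries_on_ball hf hz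
  simp only [sub_zero, smul_eq_mul] at this
  rwa [show (fun n => taylorCoeff f n * z ^ n) = fun n : ℕ => (n.factorial : ℂ)⁻¹ *
    (z ^ n * iteratedDeriv n f 0) from funext fun n => by rw [taylorCoeff]; ring]

theorem taylorCoeff_deriv (f : ℂ → ℂ) (n : ℕ) :
    taylorCoeff (deriv f) n = (n + 1) * taylorCoeff f (n + 1) := by
  rw [taylorCoeff, taylorCoeff, iteratedDeriv_succ', Nat.factorial_succ]
  push_cast
  have h1 : (n : ℂ) + 1 ≠ 0 := Nat.cast_add_one_ne_zero n
  have h2 : (n.factorial : ℂ) ≠ 0 := Nat.cast_ne_zero.2 n.factorial_ne_zero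
  field_simp

theorem hasSum_id_mul_deriv {f : ℂ → ℂ} (hf : DifferentiableOn ℂ f (ball 0 1)) {z : ℂ}
    (hz : z ∈ ball (0 : ℂ) 1) :
    HasSum (fun n => (n * taylorCoeff f n) * z ^ n) (z * deriv f z) := by
  have := (hasSum_taylorCoeff (hf.deriv isOpen_ball) hz).mul_left z
  rw [← hasSum_nat_add_iff' 1]
  simp only [taylorCoeff_deriv] at this
  simpa [pow_succ, mul_comm, mul_assoc, mul_left_comm] using this

theorem hasSum_mul_antidiagonal {c d : ℕ → ℂ} {f g : ℂ → ℂ}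
    (hf : ∀ z ∈ ball (0 : ℂ) 1, HasSum (fun n => c n * z ^ n) (f z))
    (hg : ∀ z ∈ ball (0 : ℂ) 1, HasSum (fun n => d n * z ^ n) (g z)) {z : ℂ}
    (hz : z ∈ ball (0 : ℂ) 1) :
    HasSum (fun n => (∑ kl ∈ Finset.HasAntidiagonal.antidiagonal n, c kl.1 * d kl.2) * z ^ n) (f z * g z) := by
  have h1 := (hf z hz).summable.norm
  have h2 := (hg z hz).summable.norm
  have h3 := tsum_mul_tsum_eq_tsum_sum_antidiagonal_of_summable_norm h1 h2
  rw [(hf z hz).tsum_eq, (hg z hz).tsum_eq] at h3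
  rw [h3]
  suffices h4 : (fun n => (∑ kl ∈ Finset.HasAntidiagonal.antidiagonal n, c kl.1 * d kl.2) * z ^ n) =
      fun n => ∑ kl ∈ Finset.HasAntidiagonal.antidiagonal n,
        c kl.1 * z ^ kl.1 * (d kl.2 * z ^ kl.2) by
    rw [h4]
    exact (summable_norm_sum_mul_antidiagonal_of_summable_norm h1 h2).of_norm.hasSum
  funext n
  rw [Finset.sum_mul]
  refine Finset.sum_congr rfl fun kl hkl => ?_
  rw [← Finset.HasAntidiagonal.mem_antidiagonal.1 hkl, pow_add]; ring

theorem coeff_eq_circleAverage {c : ℕ → ℂ} {f : ℂ → ℂ} (hfd : DifferentiableOn ℂ f (ball 0 1))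
    (hf : ∀ z ∈ ball (0 : ℂ) 1, HasSum (fun n => c n * z ^ n) (f z)) {r : NNReal} (hr0 : 0 < r)
    (hr : r < 1) (n : ℕ) : c n = Real.circleAverage (fun z => (z ^ n)⁻¹ * f z) 0 r := by
  have h1 := (hasFPowerSeriesOnBall_of_hasSum hf).hasFPowerSeriesAt
  have h2 := ((hfd.mono (closedBall_subset_ball
    (show (r : ℝ) < 1 by exact_mod_cast hr))).hasFPowerSeriesOnBall hr0).hasFPowerSeriesAt
  have h3 := congrArg (fun p => p n fun _ => (1 : ℂ)) (h1.eq_formalMultilinearSeries h2)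
  simp only [cauchyPowerSeries_apply, FormalMultilinearSeries.ofScalars_apply_eq, one_pow,
    smul_eq_mul, mul_one] at h3
  rw [h3, Real.circleAverage_eq_circleIntegral (by exact_mod_cast hr0.ne')]
  simp only [smul_eq_mul, sub_zero]
  congr 2
  ext z
  simp [mul_left_comm]

/-- Carathéodory's coefficient bound. -/
theorem norm_coeff_le_two {P : ℂ → ℂ} (hP : DifferentiableOn ℂ P (ball 0 1)) (hP0 : P 0 = 1)
    (hpos : ∀ z ∈ ball (0 : ℂ) 1, 0 < (P z).re) {c : ℕ → ℂ}
    (hc : ∀ z ∈ ball (0 : ℂ) 1, HasSum (fun n => c n * z ^ n) (P z)) {n : ℕ} (hn : n ≠ 0) :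
    ‖c n‖ ≤ 2 := by
  have key : ∀ r : NNReal, 0 < r → r < 1 → ‖c n‖ * (r : ℝ) ^ n ≤ 2 := fun r hr0 hr => by
    have hr0' : (0 : ℝ) < r := hr0
    have hr' : (r : ℝ) < 1 := hr
    have habs : |(r : ℝ)| = r := abs_of_pos hr0'
    have hsub : closedBall (0 : ℂ) r ⊆ ball 0 1 := closedBall_subset_ball hr'
    have hsph : sphere (0 : ℂ) |(r : ℝ)| ⊆ ball 0 1 := by
      rw [habs]; exact sphere_subset_closedBall.trans hsub
    have hne : ∀ z ∈ sphere (0 : ℂ) |(r : ℝ)|, z ≠ 0 := fun z hz h => by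
      rw [h, habs] at hz
      simp at hz
      exact hr0'.ne hz
    have hmv : ∀ k : ℂ → ℂ, DifferentiableOn ℂ k (ball 0 1) →
        Real.circleAverage k 0 r = k 0 := fun k hk =>
      DiffContOnCl.circleAverage (DifferentiableOn.diffContOnCl (hk.mono (by
        rw [habs]; exact closure_ball_subset_closedBall.trans hsub)))
    have hci : ∀ k : ℂ → ℂ, ContinuousOn k (sphere (0 : ℂ) |(r : ℝ)|) → CircleIntegrable k 0 r :=
      fun k hk => hk.circleIntegrable'
    have hPc : ContinuousOn P (sphere (0 : ℂ) |(r : ℝ)|) := hP.continuousOn.mono hsph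
    have hinv : ContinuousOn (fun z : ℂ => (z ^ n)⁻¹) (sphere (0 : ℂ) |(r : ℝ)|) :=
      (continuousOn_id.pow n).inv₀ fun z hz => pow_ne_zero n (hne z hz)
    have h1 := coeff_eq_circleAverage hP hc hr0 hr n
    -- On `|z| = r`, `z⁻ⁿ conj P = r⁻²ⁿ conj (zⁿ P)`, and `zⁿ P` has mean `0` because it vanishes at
    -- the origin.
    have h2 : Real.circleAverage (fun z => (z ^ n)⁻¹ * (starRingEnd ℂ) (P z)) 0 r = 0 := by
      have h3 := hmv (fun z => z ^ n * P z) ((differentiableOn_id.pow n).mul hP)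
      simp only [zero_pow hn, zero_mul] at h3
      have h4 := ContinuousLinearMap.circleAverage_comp_comm (E := ℂ) (F := ℂ) (conjCLE : ℂ →L[ℝ] ℂ)
        (hci (fun z => z ^ n * P z) ((continuousOn_id.pow n).mul hPc))
      rw [h3, map_zero] at h4
      have h5 := Real.circleAverage_fun_smul (a := (((r : ℝ) : ℂ) ^ (2 * n))⁻¹)
        (f := ((conjCLE : ℂ →L[ℝ] ℂ) ∘ fun z => z ^ n * P z : ℂ → ℂ)) (c := 0) (R := r)
      rw [h4, smul_zero] at h5
      refine (Real.circleAverage_congr_sphere fun z hz => ?_).trans h5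
      have h6 : z * (starRingEnd ℂ) z = ((r : ℝ) : ℂ) ^ 2 := by
        rw [mul_conj, normSq_eq_norm_sq, mem_sphere_zero_iff_norm.1 hz, habs]; simp
      have h7 := hne z hz
      have h8 : ((r : ℝ) : ℂ) ≠ 0 := ofReal_ne_zero.2 hr0'.ne'
      simp only [Function.comp_apply, smul_eq_mul, ContinuousLinearEquiv.coe_coe, conjCLE_apply,
        map_mul, map_pow]
      rw [pow_mul, ← h6, mul_pow, mul_inv]
      have h9 : (starRingEnd ℂ) z ≠ 0 := by simpa using h7
      field_simp
    -- Adding this zero mean replaces `P` by `2 Re P`; being positive, it can be estimated by its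
    -- own mean `2 Re P(0) = 2`.
    have h3 : c n = Real.circleAverage (fun z => (z ^ n)⁻¹ * (2 * (P z).re : ℝ)) 0 r := by
      have := Real.circleAverage_fun_add (hci (fun z => (z ^ n)⁻¹ * P z) (hinv.mul hPc))
        (hci (fun z => (z ^ n)⁻¹ * (starRingEnd ℂ) (P z))
          (hinv.mul (continuous_conj.comp_continuousOn hPc)))
      rw [h2, add_zero, ← h1] at this
      rw [← this]
      refine Real.circleAverage_congr_sphere fun z _ => ?_
      rw [← mul_add, add_conj]
    have h4 : ‖c n‖ ≤ Real.circleAverage (fun z => ((r : ℝ) ^ n)⁻¹ * (2 * (P z).re)) 0 r := by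
      rw [h3, Real.circleAverage_def, Real.circleAverage_def, norm_smul, smul_eq_mul,
        Real.norm_of_nonneg (by positivity)]
      refine mul_le_mul_of_nonneg_left ?_ (by positivity)
      refine (intervalIntegral.norm_integral_le_integral_norm (by positivity)).trans_eq ?_
      refine intervalIntegral.integral_congr fun θ _ => ?_
      have h5 : circleMap 0 r θ ∈ ball (0 : ℂ) 1 := by simpa [habs] using hr'
      rw [norm_mul, norm_inv, norm_pow, norm_real, norm_circleMap_zero, habs, Real.norm_of_nonneg (mul_nonneg zero_le_two (hpos _ h5).le)]
    have h5 : Real.circleAverage (fun z => ((r : ℝ) ^ n)⁻¹ * (2 * (P z).re)) 0 r =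
        ((r : ℝ) ^ n)⁻¹ * 2 := by
      have h6 := reCLM.circleAverage_comp_comm (hci P hPc)
      rw [hmv P hP, hP0] at h6
      have h7 := Real.circleAverage_fun_smul (a := ((r : ℝ) ^ n)⁻¹ * 2)
        (f := reCLM ∘ P) (c := 0) (R := r)
      rw [h6] at h7
      simp only [Function.comp_apply, reCLM_apply, smul_eq_mul, one_re, mul_one, mul_assoc] at h7
      exact h7
    rw [h5] at h4
    have h6 := pow_pos hr0' n
    calc ‖c n‖ * (r : ℝ) ^ n ≤ ((r : ℝ) ^ n)⁻¹ * 2 * (r : ℝ) ^ n := by gcongr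
      _ = 2 := by field_simp
  have hlim : Tendsto (fun x : ℝ => ‖c n‖ * x ^ n) (𝓝[<] 1) (𝓝 (‖c n‖ * 1 ^ n)) :=
    (Continuous.tendsto (by fun_prop) 1).mono_left nhdsWithin_le_nhds
  rw [one_pow, mul_one] at hlim
  refine le_of_tendsto hlim ?_
  filter_upwards [Ioo_mem_nhdsLT (show (0 : ℝ) < 1 from one_pos)] with x hx
  exact key ⟨x, hx.1.le⟩ hx.1 hx.2

/-! ### Coefficient bounds, extremal functions and the disc of radius one half -/

theorem hasDerivAt_cayley {P : ℂ → ℂ} {P' z : ℂ} (hP : HasDerivAt P P' z) (h : P z + 1 ≠ 0) :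
    HasDerivAt (fun z => (P z - 1) / (P z + 1)) (2 * P' / (P z + 1) ^ 2) z :=
  ((hP.sub_const 1).div (hP.add_const 1) h).congr_deriv (by ring)

theorem add_one_ne_zero_of_re_pos {w : ℂ} (h : 0 < w.re) : w + 1 ≠ 0 := fun h0 => by
  have := congrArg re h0
  rw [add_re, one_re, zero_re] at this
  linarith

theorem norm_cayley_le_one {w : ℂ} (h : 0 < w.re) : ‖(w - 1) / (w + 1)‖ ≤ 1 := by
  rw [norm_div]
  refine div_le_one_of_le₀ ?_ (norm_nonneg _)
  refine le_of_pow_le_pow_left₀ two_ne_zero (norm_nonneg _) ?_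
  rw [← normSq_eq_norm_sq, ← normSq_eq_norm_sq, normSq_apply, normSq_apply]
  simp
  nlinarith

/-- Schwarz's lemma for the Cayley transform `w = (P - 1) / (P + 1)`, for which `w 0 = 0` and `w' 0
= P' 0 / 2`. Equality makes `w` linear, which determines `P`. -/
theorem cayley_schwarz {P : ℂ → ℂ} (hP : DifferentiableOn ℂ P (ball 0 1)) (hP0 : P 0 = 1)
    (hpos : ∀ z ∈ ball (0 : ℂ) 1, 0 < (P z).re) :
    ‖deriv P 0‖ ≤ 2 ∧ (‖deriv P 0‖ = 2 →
      ∀ z ∈ ball (0 : ℂ) 1, P z * (1 - deriv P 0 / 2 * z) = 1 + deriv P 0 / 2 * z) := by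
  have h0 : (0 : ℂ) ∈ ball (0 : ℂ) 1 := mem_ball_self one_pos
  set w : ℂ → ℂ := fun z => (P z - 1) / (P z + 1) with hw
  have hd : ∀ z ∈ ball (0 : ℂ) 1, HasDerivAt w (2 * deriv P z / (P z + 1) ^ 2) z := fun z hz =>
    hasDerivAt_cayley (hP.differentiableAt (isOpen_ball.mem_nhds hz)).hasDerivAt
      (add_one_ne_zero_of_re_pos (hpos z hz))
  have hw0 : w 0 = 0 := by simp [hw, hP0]
  have hwd : DifferentiableOn ℂ w (ball 0 1) := fun z hz =>
    (hd z hz).differentiableAt.differentiableWithinAt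
  have hwm : MapsTo w (ball 0 1) (closedBall (w 0) 1) := fun z hz => by
    rw [hw0, mem_closedBall_zero_iff]
    exact norm_cayley_le_one (hpos z hz)
  have hw1 : deriv w 0 = deriv P 0 / 2 := by
    rw [(hd 0 h0).deriv, hP0]; ring
  constructor
  · have := norm_deriv_le_one_of_mapsTo_ball hwd hwm one_pos
    rw [hw1, norm_div] at this
    simp at this
    linarith
  · intro h2 z hz
    have := affine_of_mapsTo_ball_of_norm_dslope_eq_div hwd hwm h0 (by
      rw [dslope_same, hw1, norm_div, h2]; simp) hz
    rw [dslope_same, hw1] at this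
    simp only [hw0, smul_eq_mul, sub_zero, zero_add] at this
    simp only [hw] at this
    rw [div_eq_iff (add_one_ne_zero_of_re_pos (hpos z hz))] at this
    linear_combination this

theorem taylorCoeff_zero (f : ℂ → ℂ) : taylorCoeff f 0 = f 0 := by simp [taylorCoeff]

theorem taylorCoeff_one (f : ℂ → ℂ) : taylorCoeff f 1 = deriv f 0 := by simp [taylorCoeff]

/-- Comparison of coefficients in `F P = z F'`; the `-1` is the term `k = n`, moved to the left
using `P 0 = 1`. -/
theorem sub_one_mul_taylorCoeff {F P : ℂ → ℂ} (hF : DifferentiableOn ℂ F (ball 0 1))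
    (hP : DifferentiableOn ℂ P (ball 0 1)) (hP0 : P 0 = 1)
    (h : ∀ z ∈ ball (0 : ℂ) 1, F z * P z = z * deriv F z) (n : ℕ) :
    ((n : ℂ) - 1) * taylorCoeff F n =
      ∑ k ∈ Finset.range n, taylorCoeff F k * taylorCoeff P (n - k) := by
  have h1 := congrFun (coeff_unique
    (fun z hz => hasSum_mul_antidiagonal (fun _ hz => hasSum_taylorCoeff hF hz)
      (fun _ hz => hasSum_taylorCoeff hP hz) hz) (fun z hz => hasSum_id_mul_deriv hF hz) h) n
  rw [Finset.Nat.sum_antidiagonal_eq_sum_range_succ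
    (fun k l => taylorCoeff F k * taylorCoeff P l), Finset.sum_range_succ, Nat.sub_self,
    taylorCoeff_zero P, hP0] at h1
  linear_combination -h1

theorem sum_range_two_mul (n : ℕ) : ∑ k ∈ Finset.range n, (k : ℝ) * 2 = n * (n - 1) := by
  induction n with
  | zero => simp
  | succ n ih => rw [Finset.sum_range_succ, ih]; push_cast; ring

/-- By strong induction the recursion gives `(n - 1) |a_n| ≤ ∑ 2k = n (n - 1)`. -/
theorem norm_taylorCoeff_le {F P : ℂ → ℂ} (hF : DifferentiableOn ℂ F (ball 0 1))
    (hF0 : F 0 = 0) (hF1 : deriv F 0 = 1)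
    (hP : DifferentiableOn ℂ P (ball 0 1)) (hP0 : P 0 = 1)
    (hpos : ∀ z ∈ ball (0 : ℂ) 1, 0 < (P z).re)
    (h : ∀ z ∈ ball (0 : ℂ) 1, F z * P z = z * deriv F z) (n : ℕ) : ‖taylorCoeff F n‖ ≤ n := by
  induction n using Nat.strong_induction_on with
  | _ n ih =>
    match n with
    | 0 => simp [taylorCoeff_zero, hF0]
    | 1 => simp [taylorCoeff_one, hF1]
    | n + 2 =>
      have h1 := congrArg norm (sub_one_mul_taylorCoeff hF hP hP0 h (n + 2))
      have h2 : ‖((n + 2 : ℕ) : ℂ) - 1‖ = n + 1 := by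
        rw [show ((n + 2 : ℕ) : ℂ) - 1 = ((n + 1 : ℕ) : ℂ) by push_cast; ring, norm_natCast]
        push_cast; rfl
      have h3 : ‖∑ k ∈ Finset.range (n + 2), taylorCoeff F k * taylorCoeff P (n + 2 - k)‖ ≤
          ((n + 2 : ℕ) : ℝ) * ((n + 2 : ℕ) - 1) := by
        rw [← sum_range_two_mul]
        refine norm_sum_le_of_le _ fun k hk => ?_
        rw [norm_mul]
        have hk' := Finset.mem_range.1 hk
        exact mul_le_mul (ih k hk') (norm_coeff_le_two hP hP0 hpos
          (fun _ hz => hasSum_taylorCoeff hP hz) (by omega)) (norm_nonneg _) (Nat.cast_nonneg _)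
      rw [norm_mul, h2] at h1
      rw [← h1] at h3
      push_cast at h3 ⊢
      have h4 : (0 : ℝ) < n + 1 := by positivity
      nlinarith

theorem norm_deriv_eq_two_of_norm_taylorCoeff_eq {F P : ℂ → ℂ}
    (hF : DifferentiableOn ℂ F (ball 0 1)) (hF0 : F 0 = 0) (hF1 : deriv F 0 = 1)
    (hP : DifferentiableOn ℂ P (ball 0 1)) (hP0 : P 0 = 1)
    (hpos : ∀ z ∈ ball (0 : ℂ) 1, 0 < (P z).re)
    (h : ∀ z ∈ ball (0 : ℂ) 1, F z * P z = z * deriv F z) {n : ℕ} (hn : 2 ≤ n)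
    (heq : ‖taylorCoeff F n‖ = n) : ‖deriv P 0‖ = 2 := by
  refine le_antisymm (cayley_schwarz hP hP0 hpos).1 ?_
  obtain ⟨n, rfl⟩ := Nat.exists_eq_add_of_le' hn
  have h1 := congrArg norm (sub_one_mul_taylorCoeff hF hP hP0 h (n + 2))
  have h2 : ‖((n + 2 : ℕ) : ℂ) - 1‖ = n + 1 := by
    rw [show ((n + 2 : ℕ) : ℂ) - 1 = ((n + 1 : ℕ) : ℂ) by push_cast; ring, norm_natCast]
    push_cast; rfl
  -- The term `a_{n+1} p_1` is split off. The remaining terms contribute at most `(n + 1) n` of the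
  -- required `(n + 1) (n + 2)`, which leaves `|p_1| ≥ 2`.
  rw [norm_mul, h2, heq, Finset.sum_range_succ, show n + 2 - (n + 1) = 1 by omega,
    taylorCoeff_one P] at h1
  have h3 : ‖∑ k ∈ Finset.range (n + 1), taylorCoeff F k * taylorCoeff P (n + 2 - k)‖ ≤
      ((n + 1 : ℕ) : ℝ) * ((n + 1 : ℕ) - 1) := by
    rw [← sum_range_two_mul]
    refine norm_sum_le_of_le _ fun k hk => ?_
    rw [norm_mul]
    have hk' := Finset.mem_range.1 hk
    exact mul_le_mul (norm_taylorCoeff_le hF hF0 hF1 hP hP0 hpos h k)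
      (norm_coeff_le_two hP hP0 hpos (fun _ hz => hasSum_taylorCoeff hP hz) (by omega))
      (norm_nonneg _) (Nat.cast_nonneg _)
  have h4 := (norm_add_le (∑ k ∈ Finset.range (n + 1), taylorCoeff F k * taylorCoeff P (n + 2 - k))
    (taylorCoeff F (n + 1) * deriv P 0)).trans (add_le_add h3 (norm_mul_le _ _))
  have h5 := mul_le_mul_of_nonneg_right
    (norm_taylorCoeff_le hF hF0 hF1 hP hP0 hpos h (n + 1)) (norm_nonneg (deriv P 0))
  rw [← h1] at h4
  push_cast at h4 h5
  have h6 : (0 : ℝ) < n + 1 := by positivity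
  by_contra! hc
  nlinarith

theorem differentiableOn_one_add_id_mul_deriv {H : ℂ → ℂ}
    (hH : DifferentiableOn ℂ H (ball 0 1)) :
    DifferentiableOn ℂ (fun z => 1 + z * deriv H z) (ball 0 1) :=
  (differentiableOn_const 1).add (differentiableOn_id.mul (hH.deriv isOpen_ball))

theorem deriv_one_add_id_mul_deriv {H : ℂ → ℂ} (hH : DifferentiableOn ℂ H (ball 0 1)) :
    deriv (fun z => 1 + z * deriv H z) 0 = deriv H 0 := by
  have h0 : (0 : ℂ) ∈ ball (0 : ℂ) 1 := mem_ball_self one_pos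
  have h1 := ((hH.deriv isOpen_ball).differentiableAt (isOpen_ball.mem_nhds h0)).hasDerivAt
  have := (((hasDerivAt_id (0 : ℂ)).mul h1).const_add 1).deriv
  simpa using this

/-- In the extremal case `1 + z H' = (1 + ε z) / (1 - ε z)` with `ε = H' 0 / 2`, so `H' = 2ε / (1 -
ε z)` and the product has derivative zero. -/
theorem exp_mul_sq_eq_one {H : ℂ → ℂ} (hH : DifferentiableOn ℂ H (ball 0 1))
    (hH0 : exp (H 0) = 1) (hpos : ∀ z ∈ ball (0 : ℂ) 1, 0 < (1 + z * deriv H z).re)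
    (h2 : ‖deriv H 0‖ = 2) :
    ∀ z ∈ ball (0 : ℂ) 1, exp (H z) * (1 - deriv H 0 / 2 * z) ^ 2 = 1 := by
  have h0 : (0 : ℂ) ∈ ball (0 : ℂ) 1 := mem_ball_self one_pos
  have hd0 := deriv_one_add_id_mul_deriv hH
  have hP := (cayley_schwarz (differentiableOn_one_add_id_mul_deriv hH) (by simp) hpos).2
    (by rw [hd0, h2])
  rw [hd0] at hP
  set ε := deriv H 0 / 2 with hε
  set K : ℂ → ℂ := fun z => exp (H z) * (1 - ε * z) ^ 2 with hK
  have hKd : ∀ z ∈ ball (0 : ℂ) 1, HasDerivAt K 0 z := fun z hz => by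
    have h1 := (hH.differentiableAt (isOpen_ball.mem_nhds hz)).hasDerivAt.cexp
    have h3 : HasDerivAt (fun z => 1 - ε * z) (-ε) z := by
      simpa using ((hasDerivAt_id z).const_mul ε).const_sub 1
    have h4 : deriv H z * (1 - ε * z) = 2 * ε := by
      rcases eq_or_ne z 0 with rfl | hz0
      · rw [hε]; ring
      · refine mul_left_cancel₀ hz0 ?_
        linear_combination hP z hz
    refine (h1.mul (h3.pow 2)).congr_deriv ?_
    simp only [Pi.pow_apply, Nat.cast_ofNat, Nat.add_one_sub_one, pow_one]
    linear_combination (exp (H z) * (1 - ε * z)) * h4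
  intro z hz
  have := isOpen_ball.is_const_of_deriv_eq_zero (convex_ball (0 : ℂ) 1).isPreconnected
    (f := K) (fun z hz => (hKd z hz).differentiableAt.differentiableWithinAt)
    (fun z hz => (hKd z hz).deriv) hz h0
  rw [show exp (H z) * (1 - ε * z) ^ 2 = K z from rfl, this]
  simp [hK, hH0]

/-- Equality for one `n ≥ 2` gives `|H' 0| = 2`, and `a_2 = H' 0`. Writing the extremal function
through `a_2` will allow its parameter to be recognized as real. -/
theorem starlike_coefficients {F H : ℂ → ℂ} (hH : DifferentiableOn ℂ H (ball 0 1))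
    (hF : ∀ z ∈ ball (0 : ℂ) 1, F z = z * exp (H z)) (hF1 : deriv F 0 = 1)
    (hpos : ∀ z ∈ ball (0 : ℂ) 1, 0 < (1 + z * deriv H z).re) :
    (∀ n, ‖taylorCoeff F n‖ ≤ n) ∧ ∀ n, 2 ≤ n → ‖taylorCoeff F n‖ = n →
      ‖taylorCoeff F 2‖ = 2 ∧
        ∀ z ∈ ball (0 : ℂ) 1, exp (H z) * (1 - taylorCoeff F 2 / 2 * z) ^ 2 = 1 := by
  have h0 : (0 : ℂ) ∈ ball (0 : ℂ) 1 := mem_ball_self one_pos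
  have hFd : ∀ z ∈ ball (0 : ℂ) 1, HasDerivAt F (exp (H z) * (1 + z * deriv H z)) z :=
    fun z hz => (hasDerivAt_id_mul_exp hH hz).congr_of_eventuallyEq (by
      filter_upwards [isOpen_ball.mem_nhds hz] with w hw using hF w hw)
  have hFD : DifferentiableOn ℂ F (ball 0 1) := fun z hz =>
    (hFd z hz).differentiableAt.differentiableWithinAt
  have hF0 : F 0 = 0 := by rw [hF 0 h0, zero_mul]
  have hH0 : exp (H 0) = 1 := by
    rw [← hF1, (hFd 0 h0).deriv]; simp
  have hP := differentiableOn_one_add_id_mul_deriv hH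
  have hFP : ∀ z ∈ ball (0 : ℂ) 1, F z * (1 + z * deriv H z) = z * deriv F z := fun z hz => by
    rw [(hFd z hz).deriv, hF z hz]; ring
  refine ⟨norm_taylorCoeff_le hFD hF0 hF1 hP (by simp) hpos hFP, fun n hn heq => ?_⟩
  have h2 := norm_deriv_eq_two_of_norm_taylorCoeff_eq hFD hF0 hF1 hP (by simp) hpos hFP hn heq
  have h3 : taylorCoeff F 2 = deriv H 0 := by
    have h := sub_one_mul_taylorCoeff hFD hP (by simp) hFP 2
    simp only [Finset.sum_range_succ, Finset.sum_range_zero, taylorCoeff_zero, hF0,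
      taylorCoeff_one, hF1] at h
    norm_num at h
    simpa [taylorCoeff_one, deriv_one_add_id_mul_deriv hH] using h
  rw [deriv_one_add_id_mul_deriv hH] at h2
  rw [h3]
  exact ⟨h2, exp_mul_sq_eq_one hH hH0 hpos h2⟩

/-- The function `z F' = z exp H` is covered by the starlike case and has coefficients `n a_n`; in
the extremal case `F' = (1 - a_2 z)⁻²` is integrated. -/
theorem convex_coefficients {F H : ℂ → ℂ} (hH : DifferentiableOn ℂ H (ball 0 1))
    (hF : ∀ z ∈ ball (0 : ℂ) 1, HasDerivAt F (exp (H z)) z) (hF0 : F 0 = 0)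
    (hF1 : deriv F 0 = 1)
    (hpos : ∀ z ∈ ball (0 : ℂ) 1, 0 < (1 + z * deriv H z).re) :
    (∀ n, 2 ≤ n → ‖taylorCoeff F n‖ ≤ 1) ∧ ∀ n, 2 ≤ n → ‖taylorCoeff F n‖ = 1 →
      ‖taylorCoeff F 2‖ = 1 ∧ ∀ z ∈ ball (0 : ℂ) 1, 1 - taylorCoeff F 2 * z ≠ 0 ∧
        F z = z / (1 - taylorCoeff F 2 * z) := by
  have h0 : (0 : ℂ) ∈ ball (0 : ℂ) 1 := mem_ball_self one_pos
  have hFD : DifferentiableOn ℂ F (ball 0 1) := fun z hz =>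
    (hF z hz).differentiableAt.differentiableWithinAt
  have hH0 : exp (H 0) = 1 := by rw [← hF1, (hF 0 h0).deriv]
  have hGd : DifferentiableOn ℂ (fun z => z * exp (H z)) (ball 0 1) := fun z hz =>
    (hasDerivAt_id_mul_exp hH hz).differentiableAt.differentiableWithinAt
  have hcoef : ∀ n : ℕ, taylorCoeff (fun z => z * exp (H z)) n = n * taylorCoeff F n :=
    congrFun (coeff_unique (fun _ hz => hasSum_taylorCoeff hGd hz)
      (fun _ hz => hasSum_id_mul_deriv hFD hz) fun z hz => by rw [(hF z hz).deriv])
  have hG1 : deriv (fun z => z * exp (H z)) 0 = 1 := by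
    rw [(hasDerivAt_id_mul_exp hH h0).deriv, hH0]; simp
  obtain ⟨h1, h2⟩ := starlike_coefficients hH (fun _ _ => rfl) hG1 hpos
  simp only [hcoef, norm_mul, norm_natCast] at h1 h2
  refine ⟨fun n hn => ?_, fun n hn heq => ?_⟩
  · have hn0 : (0 : ℝ) < n := by exact_mod_cast (show 0 < n by omega)
    have := h1 n
    nlinarith
  · obtain ⟨h3, h4⟩ := h2 n hn (by rw [heq, mul_one])
    push_cast at h3 h4
    have h5 : ‖taylorCoeff F 2‖ = 1 := by linarith
    refine ⟨h5, ?_⟩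
    set ε := taylorCoeff F 2 with hε
    have h6 : ∀ z ∈ ball (0 : ℂ) 1, exp (H z) * (1 - ε * z) ^ 2 = 1 := fun z hz => by
      linear_combination h4 z hz
    have hne : ∀ z ∈ ball (0 : ℂ) 1, 1 - ε * z ≠ 0 := fun z hz h => by
      have := h6 z hz
      rw [h] at this
      simp at this
    have hd : ∀ z ∈ ball (0 : ℂ) 1, HasDerivAt (fun z => F z - z / (1 - ε * z)) 0 z :=
      fun z hz => by
        have h7 : HasDerivAt (fun z => 1 - ε * z) (-ε) z := by
          simpa using ((hasDerivAt_id z).const_mul ε).const_sub 1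
        refine ((hF z hz).sub ((hasDerivAt_id z).div h7 (hne z hz))).congr_deriv ?_
        have := hne z hz
        simp only [id]
        field_simp
        linear_combination h6 z hz
    intro z hz
    refine ⟨hne z hz, ?_⟩
    have := isOpen_ball.is_const_of_deriv_eq_zero (convex_ball (0 : ℂ) 1).isPreconnected
      (fun z hz => (hd z hz).differentiableAt.differentiableWithinAt)
      (fun z hz => (hd z hz).deriv) hz h0
    simp only [hF0, zero_div, sub_zero] at this
    exact sub_eq_zero.1 this

/-- A convex image of the disc under a normalized function contains the disc of radius `1/2`. -/
theorem ball_half_subset_of_convex {F : ℂ → ℂ} (hF : DifferentiableOn ℂ F (ball 0 1))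
    (hF0 : F 0 = 0) (hF1 : deriv F 0 = 1) (hopen : IsOpen (F '' ball 0 1))
    (hc : Convex ℝ (F '' ball 0 1)) : ball (0 : ℂ) (1 / 2) ⊆ F '' ball 0 1 := by
  have h0 : (0 : ℂ) ∈ ball (0 : ℂ) 1 := mem_ball_self one_pos
  intro w hw
  by_contra hnot
  obtain ⟨f, hf⟩ := geometric_hahn_banach_open_point hc hopen hnot
  -- The complex number representing the separating real functional as `Re (l z)`.
  set l : ℂ := f 1 - f I * I with hl
  have hfl : ∀ z, f z = (l * z).re := fun z => by
    have : z = z.re • (1 : ℂ) + z.im • I := by simp [re_add_im]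
    conv_lhs => rw [this, map_add, map_smul, map_smul]
    simp [hl]
    ring
  set d : ℝ := f w with hd
  have hd0 : 0 < d := by
    have := hf (F 0) (mem_image_of_mem F h0)
    rwa [hF0, map_zero] at this
  have hdC : (d : ℂ) ≠ 0 := ofReal_ne_zero.2 hd0.ne'
  -- Separation gives `Re (1 - l F / d) > 0`. Its derivative at `0` is `-l / d`, so `|l| ≤ 2d ≤ 2
  -- |l| |w|`, contradicting `|w| < 1/2`.
  have hP : DifferentiableOn ℂ (fun z => 1 - l * F z / d) (ball 0 1) :=
    (differentiableOn_const 1).sub ((hF.const_mul l).div_const _)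
  have h1 := (cayley_schwarz hP (by simp [hF0]) fun z hz => by
    have := hf (F z) (mem_image_of_mem F hz)
    rw [hfl (F z)] at this
    rw [sub_re, one_re, div_ofReal_re, sub_pos, div_lt_one hd0]
    exact this).1
  have h2 : deriv (fun z => 1 - l * F z / d) 0 = -(l / d) := by
    have := (hF.differentiableAt (isOpen_ball.mem_nhds h0)).hasDerivAt
    rw [hF1] at this
    simpa using (((this.const_mul l).div_const (d : ℂ)).const_sub 1).deriv
  rw [h2, norm_neg, norm_div, norm_real, Real.norm_of_nonneg hd0.le, div_le_iff₀ hd0] at h1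
  have h3 : d ≤ ‖l‖ * ‖w‖ := by
    rw [hd, hfl w, ← norm_mul]; exact re_le_norm _
  have h4 := mem_ball_zero_iff.1 hw
  nlinarith [norm_nonneg l, norm_nonneg w]

end SliceQuat

namespace SliceQuat

/-! ### The slices of the quaternions -/

open Metric Set Filter Topology ComplexConjugate

/-- The embedding `x + i y ↦ x + J y` of `ℂ` onto the slice `ℂ_J`. -/
noncomputable def toSlice (J : ℍ[ℝ]) (z : ℂ) : ℍ[ℝ] := pt J z.re z.im

theorem mul_self_of_mem_imagUnits {J : ℍ[ℝ]} (hJ : J ∈ imagUnits) : J * J = -1 := by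
  have h1 : star J = -J := Quaternion.star_eq_neg.2 hJ.1
  have h2 := Quaternion.self_mul_star J
  rw [h1, Quaternion.normSq_eq_norm_mul_self, hJ.2] at h2
  simpa [neg_eq_iff_eq_neg] using h2

theorem neg_mem_imagUnits {J : ℍ[ℝ]} (hJ : J ∈ imagUnits) : -J ∈ imagUnits :=
  ⟨by rw [Quaternion.re_neg, hJ.1, neg_zero], by rw [norm_neg, hJ.2]⟩

theorem star_of_mem_imagUnits {J : ℍ[ℝ]} (hJ : J ∈ imagUnits) : star J = -J :=
  Quaternion.star_eq_neg.2 hJ.1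

theorem ne_zero_of_mem_imagUnits {J : ℍ[ℝ]} (hJ : J ∈ imagUnits) : J ≠ 0 := by
  rintro rfl
  simpa using hJ.2

/-- `toSlice` as a homomorphism of real algebras. -/
noncomputable def toSliceHom {J : ℍ[ℝ]} (hJ : J ∈ imagUnits) : ℂ →ₐ[ℝ] ℍ[ℝ] :=
  Complex.liftAux J (mul_self_of_mem_imagUnits hJ)

theorem toSlice_eq_smul (J : ℍ[ℝ]) (z : ℂ) : toSlice J z = (z.re : ℍ[ℝ]) + z.im • J := by
  rw [toSlice, pt, Quaternion.mul_coe_eq_smul]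

theorem toSliceHom_apply {J : ℍ[ℝ]} (hJ : J ∈ imagUnits) (z : ℂ) :
    toSliceHom hJ z = toSlice J z := by
  rw [toSlice_eq_smul]; rfl

theorem toSlice_neg_conj (J : ℍ[ℝ]) (z : ℂ) : toSlice (-J) (conj z) = toSlice J z := by
  simp [toSlice_eq_smul]

theorem toSlice_ofReal (J : ℍ[ℝ]) (x : ℝ) : toSlice J (x : ℂ) = (x : ℍ[ℝ]) := by
  simp [toSlice_eq_smul]

theorem toSlice_of_im_eq_zero (J : ℍ[ℝ]) {z : ℂ} (hz : z.im = 0) :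
    toSlice J z = (z.re : ℍ[ℝ]) := by
  simp [toSlice_eq_smul, hz]

theorem toSlice_zero (J : ℍ[ℝ]) : toSlice J 0 = 0 := by simp [toSlice_eq_smul]

theorem toSlice_one (J : ℍ[ℝ]) : toSlice J 1 = 1 := by simp [toSlice_eq_smul]

theorem toSlice_smul (J : ℍ[ℝ]) (t : ℝ) (z : ℂ) : toSlice J (t • z) = t • toSlice J z := by
  simp [toSlice_eq_smul, mul_smul, smul_add, Quaternion.smul_coe]

theorem toSlice_add (J : ℍ[ℝ]) (z w : ℂ) : toSlice J (z + w) = toSlice J z + toSlice J w := by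
  simp only [toSlice_eq_smul, Complex.add_re, Complex.add_im, Quaternion.coe_add, add_smul]
  abel

theorem toSlice_mul {J : ℍ[ℝ]} (hJ : J ∈ imagUnits) (z w : ℂ) :
    toSlice J (z * w) = toSlice J z * toSlice J w := by
  simp only [← toSliceHom_apply hJ, map_mul]

theorem toSlice_inv {J : ℍ[ℝ]} (hJ : J ∈ imagUnits) (z : ℂ) :
    toSlice J z⁻¹ = (toSlice J z)⁻¹ := by
  simp only [← toSliceHom_apply hJ, map_inv₀]

theorem toSlice_I (J : ℍ[ℝ]) : toSlice J Complex.I = J := by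
  simp [toSlice_eq_smul]

theorem star_toSlice {J : ℍ[ℝ]} (hJ : J ∈ imagUnits) (z : ℂ) :
    star (toSlice J z) = toSlice J (conj z) := by
  simp [toSlice_eq_smul, star_of_mem_imagUnits hJ]

theorem re_toSlice {J : ℍ[ℝ]} (hJ : J ∈ imagUnits) (z : ℂ) : (toSlice J z).re = z.re := by
  simp [toSlice_eq_smul, hJ.1]

theorem im_toSlice {J : ℍ[ℝ]} (hJ : J ∈ imagUnits) (z : ℂ) : (toSlice J z).im = z.im • J := by
  have h : J.im = J := by
    have := Quaternion.re_add_im J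
    rw [hJ.1] at this
    simpa using this
  simp [toSlice_eq_smul, h]

theorem norm_im_toSlice {J : ℍ[ℝ]} (hJ : J ∈ imagUnits) (z : ℂ) :
    ‖(toSlice J z).im‖ = |z.im| := by
  rw [im_toSlice hJ, norm_smul, hJ.2, mul_one, Real.norm_eq_abs]

theorem norm_toSlice {J : ℍ[ℝ]} (hJ : J ∈ imagUnits) (z : ℂ) : ‖toSlice J z‖ = ‖z‖ := by
  have h1 : toSlice J z * star (toSlice J z) = ((Complex.normSq z : ℝ) : ℍ[ℝ]) := by
    rw [star_toSlice hJ, ← toSlice_mul hJ, Complex.mul_conj, toSlice_ofReal]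
  rw [Quaternion.self_mul_star, Quaternion.coe_inj, Quaternion.normSq_eq_norm_mul_self,
    Complex.normSq_eq_norm_sq, ← sq] at h1
  exact (pow_left_inj₀ (norm_nonneg _) (norm_nonneg _) two_ne_zero).1 h1

theorem toSlice_injective {J : ℍ[ℝ]} (hJ : J ∈ imagUnits) : Function.Injective (toSlice J) := by
  intro z w h
  have := (toSliceHom hJ).toRingHom.injective (a₁ := z) (a₂ := w)
  exact this (by simpa [toSliceHom_apply] using h)

theorem unitOf_toSlice_of_pos {J : ℍ[ℝ]} (hJ : J ∈ imagUnits) {z : ℂ} (hz : 0 < z.im) :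
    unitOf (toSlice J z) = J := by
  rw [unitOf, norm_im_toSlice hJ, im_toSlice hJ, abs_of_pos hz, smul_smul,
    inv_mul_cancel₀ hz.ne', one_smul]

theorem unitOf_toSlice_of_eq_zero {J : ℍ[ℝ]} (hJ : J ∈ imagUnits) {z : ℂ} (hz : z.im = 0) :
    unitOf (toSlice J z) = 0 := by
  rw [unitOf, im_toSlice hJ, hz, zero_smul, smul_zero]

/-- The imaginary unit `i`. -/
def unitI : ℍ[ℝ] := ⟨0, 1, 0, 0⟩

/-- The imaginary unit `j`. -/
def unitJ : ℍ[ℝ] := ⟨0, 0, 1, 0⟩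

theorem norm_eq_one_of_normSq {q : ℍ[ℝ]} (h : Quaternion.normSq q = 1) : ‖q‖ = 1 := by
  rw [Quaternion.normSq_eq_norm_mul_self] at h
  nlinarith [norm_nonneg q]

theorem unitI_mem : unitI ∈ imagUnits :=
  ⟨rfl, norm_eq_one_of_normSq (by rw [Quaternion.normSq_def']; simp [unitI])⟩

theorem unitJ_mem : unitJ ∈ imagUnits :=
  ⟨rfl, norm_eq_one_of_normSq (by rw [Quaternion.normSq_def']; simp [unitJ])⟩

theorem exists_toSlice (q : ℍ[ℝ]) : ∃ J ∈ imagUnits, ∃ z : ℂ, 0 ≤ z.im ∧ q = toSlice J z := by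
  rcases eq_or_ne q.im 0 with h | h
  · refine ⟨unitI, unitI_mem, q.re, by simp, ?_⟩
    rw [toSlice_ofReal]
    conv_lhs => rw [← Quaternion.re_add_im q, h, add_zero]
  · refine ⟨unitOf q, ⟨by simp [unitOf], ?_⟩, ⟨q.re, ‖q.im‖⟩, norm_nonneg _, ?_⟩
    · rw [unitOf, norm_smul, norm_inv, norm_norm, inv_mul_cancel₀ (norm_ne_zero_iff.2 h)]
    · rw [toSlice_eq_smul, unitOf, smul_smul, mul_inv_cancel₀ (norm_ne_zero_iff.2 h), one_smul,
        Quaternion.re_add_im]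

theorem toSlice_mem_unitBall {J : ℍ[ℝ]} (hJ : J ∈ imagUnits) {z : ℂ} :
    toSlice J z ∈ unitBall ↔ z ∈ ball (0 : ℂ) 1 := by
  rw [unitBall, mem_ball_zero_iff, mem_ball_zero_iff, norm_toSlice hJ]

theorem slicePlane_eq_range (J : ℍ[ℝ]) : slicePlane J = range (toSlice J) := by
  ext q
  constructor
  · rintro ⟨x, y, rfl⟩
    exact ⟨⟨x, y⟩, rfl⟩
  · rintro ⟨z, rfl⟩
    exact ⟨z.re, z.im, rfl⟩

theorem sliceDisc_eq_image {J : ℍ[ℝ]} (hJ : J ∈ imagUnits) :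
    sliceDisc J = toSlice J '' ball 0 1 := by
  rw [sliceDisc, slicePlane_eq_range]
  ext q
  constructor
  · rintro ⟨h, z, rfl⟩
    exact ⟨z, (toSlice_mem_unitBall hJ).1 h, rfl⟩
  · rintro ⟨z, hz, rfl⟩
    exact ⟨(toSlice_mem_unitBall hJ).2 hz, z, rfl⟩

/-- The only ambiguity in writing `q = x + J y` is the change of sign of `(J, y)`, together with the
free choice of `J` at real points. -/
theorem toSlice_eq_toSlice {J K : ℍ[ℝ]} (hJ : J ∈ imagUnits) (hK : K ∈ imagUnits) {z w : ℂ}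
    (h : toSlice J z = toSlice K w) : (z = w ∧ (z.im ≠ 0 → J = K)) ∨
      (z = conj w ∧ (z.im ≠ 0 → J = -K)) := by
  have h1 : z.re = w.re := by rw [← re_toSlice hJ, h, re_toSlice hK]
  have h2 : z.im • J = w.im • K := by rw [← im_toSlice hJ, h, im_toSlice hK]
  have h3 : |z.im| = |w.im| := by rw [← norm_im_toSlice hJ, h, norm_im_toSlice hK]
  rcases abs_eq_abs.1 h3 with h4 | h4
  · refine Or.inl ⟨Complex.ext h1 h4, fun h5 => ?_⟩
    rw [← h4] at h2
    exact smul_right_injective _ h5 h2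
  · refine Or.inr ⟨Complex.ext h1 h4, fun h5 => ?_⟩
    rw [← neg_eq_iff_eq_neg.2 h4, neg_smul, ← smul_neg] at h2
    exact smul_right_injective _ h5 h2

/-- `toSlice` as a continuous linear map. -/
noncomputable def toSliceCLM (J : ℍ[ℝ]) : ℂ →L[ℝ] ℍ[ℝ] :=
  LinearMap.toContinuousLinearMap
    { toFun := toSlice J, map_add' := toSlice_add J, map_smul' := toSlice_smul J }

theorem toSliceCLM_apply (J : ℍ[ℝ]) (z : ℂ) : toSliceCLM J z = toSlice J z := rfl

/-- The first component of `q` in the decomposition of `ℍ` as a left vector space over `ℂ_J`. -/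
noncomputable def sliceProj (J : ℍ[ℝ]) : ℍ[ℝ] →L[ℝ] ℂ :=
  LinearMap.toContinuousLinearMap
    { toFun := fun q => ⟨q.re, -(J * q).re⟩
      map_add' := fun p q => by
        apply Complex.ext <;> simp [mul_add]; ring
      map_smul' := fun t q => by
        apply Complex.ext <;> simp; ring }

theorem re_sliceProj (J q : ℍ[ℝ]) : (sliceProj J q).re = q.re := rfl

theorem im_sliceProj (J q : ℍ[ℝ]) : (sliceProj J q).im = -(J * q).re := rfl

theorem sliceProj_toSlice {J : ℍ[ℝ]} (hJ : J ∈ imagUnits) (z : ℂ) :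
    sliceProj J (toSlice J z) = z := by
  apply Complex.ext
  · rw [re_sliceProj, re_toSlice hJ]
  · rw [im_sliceProj, toSlice_eq_smul, mul_add, mul_smul_comm, mul_self_of_mem_imagUnits hJ,
      Quaternion.mul_coe_eq_smul]
    simp [hJ.1]

theorem sliceProj_mul {J : ℍ[ℝ]} (hJ : J ∈ imagUnits) (q : ℍ[ℝ]) :
    sliceProj J (J * q) = Complex.I * sliceProj J q := by
  apply Complex.ext
  · simp [re_sliceProj, im_sliceProj]
  · rw [im_sliceProj, ← mul_assoc, mul_self_of_mem_imagUnits hJ]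
    simp [re_sliceProj]

theorem hasDerivAt_mk_left (z : ℂ) : HasDerivAt (fun s : ℝ => (⟨s, z.im⟩ : ℂ)) 1 z.re := by
  have h := (Complex.ofRealCLM.hasDerivAt (x := z.re)).add_const (z.im * Complex.I)
  refine (h.congr_of_eventuallyEq (Eventually.of_forall fun s => ?_)).congr_deriv (by simp)
  exact Complex.mk_eq_add_mul_I _ _

theorem hasDerivAt_mk_right (z : ℂ) :
    HasDerivAt (fun t : ℝ => (⟨z.re, t⟩ : ℂ)) Complex.I z.im := by
  have h := ((Complex.ofRealCLM.hasDerivAt (x := z.im)).mul_const Complex.I).const_add (z.re : ℂ)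
  refine (h.congr_of_eventuallyEq (Eventually.of_forall fun s => ?_)).congr_deriv (by simp)
  exact Complex.mk_eq_add_mul_I _ _

theorem partialX_eq {J : ℍ[ℝ]} {f : ℍ[ℝ] → ℍ[ℝ]} {A : ℂ →L[ℝ] ℍ[ℝ]} {z : ℂ}
    (h : HasFDerivAt (fun w => f (toSlice J w)) A z) : partialX J f z.re z.im = A 1 :=
  (HasFDerivAt.comp_hasDerivAt_of_eq z.re h (hasDerivAt_mk_left z) rfl).deriv

theorem partialY_eq {J : ℍ[ℝ]} {f : ℍ[ℝ] → ℍ[ℝ]} {A : ℂ →L[ℝ] ℍ[ℝ]} {z : ℂ}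
    (h : HasFDerivAt (fun w => f (toSlice J w)) A z) : partialY J f z.re z.im = A Complex.I :=
  (HasFDerivAt.comp_hasDerivAt_of_eq z.im h (hasDerivAt_mk_right z) rfl).deriv

/-- The splitting of a slice regular function has holomorphic components. -/
theorem differentiableOn_sliceProj {f : ℍ[ℝ] → ℍ[ℝ]} (hf : SliceRegularOn unitBall f)
    {J : ℍ[ℝ]} (hJ : J ∈ imagUnits) :
    DifferentiableOn ℂ (fun z => sliceProj J (f (toSlice J z))) (ball 0 1) := by
  intro z hz
  have hmem : toSlice J z ∈ unitBall := (toSlice_mem_unitBall hJ).2 hz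
  have h1 : DifferentiableAt ℝ f (toSlice J z) :=
    hf.1.differentiableAt (isOpen_ball.mem_nhds hmem)
  have h2 : HasFDerivAt (fun w => f (toSlice J w)) ((fderiv ℝ f (toSlice J z)).comp
      (toSliceCLM J)) z := h1.hasFDerivAt.comp z (toSliceCLM J).hasFDerivAt
  set A := (fderiv ℝ f (toSlice J z)).comp (toSliceCLM J)
  have h3 := hf.2 J hJ z.re z.im hmem
  rw [partialX_eq h2, partialY_eq h2, smul_eq_zero] at h3
  -- Multiplying the regularity equation by `J` gives the Cauchy–Riemann relation, and `sliceProj`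
  -- turns left multiplication by `J` into multiplication by `i`.
  have h4 : A Complex.I = J * A 1 := by
    have h5 : A 1 + J * A Complex.I = 0 := h3.resolve_left (by norm_num)
    have h6 := congrArg (fun q => J * q) (eq_neg_of_add_eq_zero_left h5)
    simp only [mul_neg, ← mul_assoc, mul_self_of_mem_imagUnits hJ] at h6
    simpa using h6.symm
  have h7 : HasFDerivAt (fun w => sliceProj J (f (toSlice J w))) ((sliceProj J).comp A) z :=
    (sliceProj J).hasFDerivAt.comp z h2
  refine DifferentiableAt.differentiableWithinAt
    (differentiableAt_complex_iff_differentiableAt_real.2 ⟨h7.differentiableAt, ?_⟩)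
  rw [h7.fderiv]
  exact (congrArg (sliceProj J) h4).trans (sliceProj_mul hJ _)

/-! ### Lifts of symmetric holomorphic functions -/

/-- `f` restricts on every slice of the unit ball to a copy of the function `F` on the disc. -/
def IsLift (f : ℍ[ℝ] → ℍ[ℝ]) (F : ℂ → ℂ) : Prop :=
  ∀ J ∈ imagUnits, ∀ z ∈ ball (0 : ℂ) 1, f (toSlice J z) = toSlice J (F z)

theorem conj_mem_ball {z : ℂ} (hz : z ∈ ball (0 : ℂ) 1) : conj z ∈ ball (0 : ℂ) 1 := by
  simpa using hz

/-- The pairs `(J, z)` and `(-J, conj z)` name the same quaternion, so a function lifted to all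
slices must be symmetric. -/
theorem IsLift.map_conj {f : ℍ[ℝ] → ℍ[ℝ]} {F : ℂ → ℂ} (h : IsLift f F) {z : ℂ}
    (hz : z ∈ ball (0 : ℂ) 1) : F (conj z) = conj (F z) := by
  have h1 := h _ (neg_mem_imagUnits unitI_mem) _ (conj_mem_ball hz)
  rw [toSlice_neg_conj, h _ unitI_mem z hz, ← toSlice_neg_conj] at h1
  exact (toSlice_injective (neg_mem_imagUnits unitI_mem) h1).symm

theorem IsLift.im_eq_zero {f : ℍ[ℝ] → ℍ[ℝ]} {F : ℂ → ℂ} (h : IsLift f F) {z : ℂ}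
    (hz : z ∈ ball (0 : ℂ) 1) (hz0 : z.im = 0) : (F z).im = 0 := by
  have := h.map_conj hz
  rw [Complex.conj_eq_iff_im.2 hz0, eq_comm] at this
  exact Complex.conj_eq_iff_im.1 this

/-- The definitions use `unitOf q`, which is `J` only above the real axis; symmetry supplies the
lower half. -/
theorem isLift_of_nonneg {f : ℍ[ℝ] → ℍ[ℝ]} {F : ℂ → ℂ}
    (hF : ∀ z ∈ ball (0 : ℂ) 1, F (conj z) = conj (F z))
    (h : ∀ J ∈ imagUnits, ∀ z ∈ ball (0 : ℂ) 1, 0 ≤ z.im → f (toSlice J z) = toSlice J (F z)) :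
    IsLift f F := by
  intro J hJ z hz
  rcases le_total 0 z.im with h0 | h0
  · exact h J hJ z hz h0
  · rw [← toSlice_neg_conj, h _ (neg_mem_imagUnits hJ) _ (conj_mem_ball hz) (by simpa using h0),
      hF z hz, toSlice_neg_conj]

theorem isLift_id : IsLift (fun q => q) (fun z => z) := fun _ _ _ _ => rfl

theorem isLift_one : IsLift (fun _ => 1) (fun _ => 1) := fun J _ _ _ => (toSlice_one J).symm

theorem IsLift.add {f g : ℍ[ℝ] → ℍ[ℝ]} {F G : ℂ → ℂ} (hf : IsLift f F) (hg : IsLift g G) :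
    IsLift (fun q => f q + g q) (fun z => F z + G z) := fun J hJ z hz => by
  simp only [hf J hJ z hz, hg J hJ z hz, toSlice_add]

theorem IsLift.mul {f g : ℍ[ℝ] → ℍ[ℝ]} {F G : ℂ → ℂ} (hf : IsLift f F) (hg : IsLift g G) :
    IsLift (fun q => f q * g q) (fun z => F z * G z) := fun J hJ z hz => by
  simp only [hf J hJ z hz, hg J hJ z hz, toSlice_mul hJ]

theorem IsLift.inv {f : ℍ[ℝ] → ℍ[ℝ]} {F : ℂ → ℂ} (hf : IsLift f F) :
    IsLift (fun q => (f q)⁻¹) (fun z => (F z)⁻¹) := fun J hJ z hz => by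
  simp only [hf J hJ z hz, toSlice_inv hJ]

theorem IsLift.congr {f : ℍ[ℝ] → ℍ[ℝ]} {F G : ℂ → ℂ} (hf : IsLift f F)
    (h : ∀ z ∈ ball (0 : ℂ) 1, F z = G z) : IsLift f G := fun J hJ z hz => by
  rw [hf J hJ z hz, h z hz]

theorem IsLift.alphaPart_eq {f : ℍ[ℝ] → ℍ[ℝ]} {F : ℂ → ℂ} (hf : IsLift f F) {J : ℍ[ℝ]}
    (hJ : J ∈ imagUnits) {z : ℂ} (hz : z ∈ ball (0 : ℂ) 1) :
    alphaPart f (toSlice J z) = ((F z).re : ℍ[ℝ]) := by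
  rw [alphaPart, star_toSlice hJ, hf J hJ z hz, hf J hJ _ (conj_mem_ball hz), hf.map_conj hz,
    ← toSlice_add, Complex.add_conj, toSlice_ofReal, Quaternion.smul_coe]
  congr 1; ring

theorem IsLift.betaPart_eq {f : ℍ[ℝ] → ℍ[ℝ]} {F : ℂ → ℂ} (hf : IsLift f F) {J : ℍ[ℝ]}
    (hJ : J ∈ imagUnits) {z : ℂ} (hz : z ∈ ball (0 : ℂ) 1) (h0 : 0 ≤ z.im) :
    betaPart f (toSlice J z) = ((F z).im : ℍ[ℝ]) := by
  rcases h0.eq_or_lt with h0 | h0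
  · rw [betaPart, unitOf_toSlice_of_eq_zero hJ h0.symm, hf.im_eq_zero hz h0.symm]
    simp
  · rw [betaPart, unitOf_toSlice_of_pos hJ h0, star_toSlice hJ, hf J hJ z hz,
      hf J hJ _ (conj_mem_ball hz), hf.map_conj hz]
    have h1 : toSlice J (conj (F z)) - toSlice J (F z) = (-(2 * (F z).im)) • J := by
      simp only [toSlice_eq_smul, Complex.conj_re, Complex.conj_im, add_sub_add_left_eq_sub,
        ← sub_smul]
      congr 1; ring
    rw [h1, mul_smul_comm, mul_self_of_mem_imagUnits hJ, smul_smul, smul_neg,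
      ← Quaternion.coe_one, Quaternion.smul_coe, ← Quaternion.coe_neg]
    congr 1; ring

/-- The components of a lift are the real and imaginary parts of `F`, so the defining formula is
complex multiplication. On the real axis `unitOf` is `0`, but so are the imaginary parts. -/
theorem IsLift.starMul {f g : ℍ[ℝ] → ℍ[ℝ]} {F G : ℂ → ℂ} (hf : IsLift f F) (hg : IsLift g G) :
    IsLift (starMul f g) (fun z => F z * G z) := by
  refine isLift_of_nonneg (fun z hz => ?_) fun J hJ z hz h0 => ?_
  · rw [hf.map_conj hz, hg.map_conj hz, map_mul]
  rw [SliceQuat.starMul, hf.alphaPart_eq hJ hz, hg.alphaPart_eq hJ hz, hf.betaPart_eq hJ hz h0,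
    hg.betaPart_eq hJ hz h0]
  rcases h0.eq_or_lt with h0 | h0
  · rw [unitOf_toSlice_of_eq_zero hJ h0.symm, hf.im_eq_zero hz h0.symm, hg.im_eq_zero hz h0.symm,
      toSlice_eq_smul J (F z * G z)]
    simp [hf.im_eq_zero hz h0.symm, hg.im_eq_zero hz h0.symm]
  · rw [unitOf_toSlice_of_pos hJ h0]
    simp only [← Quaternion.coe_mul, ← Quaternion.coe_sub, ← Quaternion.coe_add]
    rw [Quaternion.mul_coe_eq_smul, toSlice_eq_smul, Complex.mul_re, Complex.mul_im]

theorem IsLift.regConj {f : ℍ[ℝ] → ℍ[ℝ]} {F : ℂ → ℂ} (hf : IsLift f F) :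
    IsLift (regConj f) F := by
  refine isLift_of_nonneg (fun z hz => hf.map_conj hz) fun J hJ z hz h0 => ?_
  rw [SliceQuat.regConj, hf.alphaPart_eq hJ hz, hf.betaPart_eq hJ hz h0, Quaternion.star_coe,
    Quaternion.star_coe, Quaternion.mul_coe_eq_smul, toSlice_eq_smul J (F z)]
  rcases h0.eq_or_lt with h0 | h0
  · rw [hf.im_eq_zero hz h0.symm]; simp
  · rw [unitOf_toSlice_of_pos hJ h0]

theorem IsLift.symmetrization {f : ℍ[ℝ] → ℍ[ℝ]} {F : ℂ → ℂ} (hf : IsLift f F) :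
    IsLift (symmetrization f) (fun z => F z * F z) := hf.starMul hf.regConj

theorem IsLift.starInv {f : ℍ[ℝ] → ℍ[ℝ]} {F : ℂ → ℂ} (hf : IsLift f F) :
    IsLift (starInv f) (fun z => (F z)⁻¹) :=
  (hf.symmetrization.inv.mul hf.regConj).congr fun z _ => by
    -- At a zero of `F` both sides are `0` by the convention `0⁻¹ = 0`, so no point of the disc is
    -- excluded.
    rcases eq_or_ne (F z) 0 with h | h
    · simp [h]
    · field_simp

theorem IsLift.hasFDerivAt {f : ℍ[ℝ] → ℍ[ℝ]} {F : ℂ → ℂ} (hf : IsLift f F)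
    (hF : DifferentiableOn ℂ F (ball 0 1)) {J : ℍ[ℝ]} (hJ : J ∈ imagUnits) {z : ℂ}
    (hz : z ∈ ball (0 : ℂ) 1) : ∃ A : ℂ →L[ℝ] ℍ[ℝ], HasFDerivAt (fun w => f (toSlice J w)) A z ∧
      A 1 = toSlice J (deriv F z) ∧ A Complex.I = J * toSlice J (deriv F z) := by
  have h1 := (hF.differentiableAt (isOpen_ball.mem_nhds hz)).hasDerivAt.hasFDerivAt.restrictScalars ℝ
  have h2 := (toSliceCLM J).hasFDerivAt.comp z h1
  refine ⟨_, h2.congr_of_eventuallyEq ?_, ?_, ?_⟩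
  · filter_upwards [isOpen_ball.mem_nhds hz] with w hw using hf J hJ w hw
  · simp [toSliceCLM_apply]
  · simp [toSliceCLM_apply, toSlice_mul hJ, toSlice_I]

theorem IsLift.sliceDeriv {f : ℍ[ℝ] → ℍ[ℝ]} {F : ℂ → ℂ} (hf : IsLift f F)
    (hF : DifferentiableOn ℂ F (ball 0 1)) : IsLift (sliceDeriv f) (deriv F) := by
  refine isLift_of_nonneg (fun z hz => ?_) fun J hJ z hz h0 => ?_
  · have h1 := (hF.differentiableAt (isOpen_ball.mem_nhds hz)).hasDerivAt.conj_conj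
    refine (h1.congr_of_eventuallyEq ?_).deriv
    filter_upwards [isOpen_ball.mem_nhds (conj_mem_ball hz)] with w hw
    have := hf.map_conj hw
    simp [this]
  obtain ⟨A, hA, hA1, hAI⟩ := hf.hasFDerivAt hF hJ hz
  rcases h0.eq_or_lt with h0 | h0
  · rw [SliceQuat.sliceDeriv, if_pos (by rw [im_toSlice hJ, ← h0, zero_smul]), re_toSlice hJ,
      ← hA1, ← partialX_eq hA, partialX]
    congr 1
    funext s
    rw [← h0, pt]; simp
  · have h1 : (toSlice J z).im ≠ 0 := by
      rw [im_toSlice hJ]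
      exact smul_ne_zero h0.ne' (ne_zero_of_mem_imagUnits hJ)
    rw [SliceQuat.sliceDeriv, if_neg h1, unitOf_toSlice_of_pos hJ h0, norm_im_toSlice hJ,
      abs_of_pos h0, re_toSlice hJ, partialX_eq hA, partialY_eq hA, hA1, hAI, ← mul_assoc,
      mul_self_of_mem_imagUnits hJ, neg_one_mul, sub_neg_eq_add, ← two_smul ℝ, smul_smul]
    norm_num

/-- Symmetry of `F` and uniqueness of the expansion make the coefficients real. -/
theorem IsLift.taylorCoeff_eq {f : ℍ[ℝ] → ℍ[ℝ]} {F : ℂ → ℂ} (hf : IsLift f F)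
    (hF : DifferentiableOn ℂ F (ball 0 1)) (n : ℕ) :
    taylorCoeff F n = ((taylorCoeff F n).re : ℂ) := by
  have h1 : (fun n => conj (taylorCoeff F n)) = taylorCoeff F := by
    refine coeff_unique (f := F) (g := F) (fun z hz => ?_)
      (fun z hz => hasSum_taylorCoeff hF hz) fun _ _ => rfl
    have h2 := Complex.hasSum_conj'.2 (hasSum_taylorCoeff hF (conj_mem_ball hz))
    simpa [hf.map_conj hz] using h2
  exact (Complex.conj_eq_iff_re.1 (congrFun h1 n)).symm

theorem mem_unitBall_iff {q : ℍ[ℝ]} :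
    q ∈ unitBall ↔ ∃ J ∈ imagUnits, ∃ z ∈ ball (0 : ℂ) 1, q = toSlice J z := by
  constructor
  · intro hq
    obtain ⟨J, hJ, z, -, rfl⟩ := exists_toSlice q
    exact ⟨J, hJ, z, (toSlice_mem_unitBall hJ).1 hq, rfl⟩
  · rintro ⟨J, hJ, z, hz, rfl⟩
    exact (toSlice_mem_unitBall hJ).2 hz

theorem IsLift.hasSum {f : ℍ[ℝ] → ℍ[ℝ]} {F : ℂ → ℂ} (hf : IsLift f F)
    (hF : DifferentiableOn ℂ F (ball 0 1)) {q : ℍ[ℝ]} (hq : q ∈ unitBall) :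
    HasSum (fun n => (taylorCoeff F n).re • q ^ n) (f q) := by
  obtain ⟨J, hJ, z, hz, rfl⟩ := mem_unitBall_iff.1 hq
  rw [hf J hJ z hz]
  have h1 := (toSliceCLM J).hasSum (hasSum_taylorCoeff hF hz)
  refine h1.congr_fun ?_
  intro n
  conv_rhs => rw [hf.taylorCoeff_eq hF n]
  rw [toSliceCLM_apply, toSlice_mul hJ, toSlice_ofReal, Quaternion.coe_mul_eq_smul,
    ← toSliceHom_apply hJ, ← toSliceHom_apply hJ, map_pow]

/-- Differentiability as a function of four real variables is not visible on single slices, least of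
all at real points; it comes from the power series with real coefficients on `ℍ`. -/
theorem IsLift.sliceRegularOn {f : ℍ[ℝ] → ℍ[ℝ]} {F : ℂ → ℂ} (hf : IsLift f F)
    (hF : DifferentiableOn ℂ F (ball 0 1)) : SliceRegularOn unitBall f := by
  refine ⟨?_, fun J hJ x y hxy => ?_⟩
  · have h := (hasFPowerSeriesOnBall_ofScalars (𝕜 := ℝ) (c := fun n => (taylorCoeff F n).re)
      (fun r hr => ?_) (fun q hq => hf.hasSum hF hq)).differentiableOn
    · refine h.mono fun q hq => ?_
      have := mem_ball_zero_iff.1 hq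
      simpa [enorm, edist_zero_right, ← NNReal.coe_lt_one] using this
    · refine (summable_norm_mul_pow_of_hasSum (fun z hz => hasSum_taylorCoeff hF hz) r.2
        (by exact_mod_cast hr)).of_nonneg_of_le (fun n => by positivity) fun n => ?_
      exact mul_le_mul_of_nonneg_right (Complex.abs_re_le_norm _) (by positivity)
  · have hz : (⟨x, y⟩ : ℂ) ∈ ball (0 : ℂ) 1 := (toSlice_mem_unitBall hJ).1 hxy
    obtain ⟨A, hA, hA1, hAI⟩ := hf.hasFDerivAt hF hJ hz
    rw [partialX_eq hA, partialY_eq hA, hA1, hAI, ← mul_assoc, mul_self_of_mem_imagUnits hJ,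
      neg_one_mul, add_neg_cancel, smul_zero]

/-- The intrinsic function on `ℍ` with the given complex restriction. -/
noncomputable def liftFun (F : ℂ → ℂ) (q : ℍ[ℝ]) : ℍ[ℝ] := toSlice (unitOf q) (F ⟨q.re, ‖q.im‖⟩)

theorem isLift_liftFun {F : ℂ → ℂ} (hF : ∀ z ∈ ball (0 : ℂ) 1, F (conj z) = conj (F z)) :
    IsLift (liftFun F) F := by
  refine isLift_of_nonneg hF fun J hJ z hz h0 => ?_
  rw [liftFun, re_toSlice hJ, norm_im_toSlice hJ, abs_of_nonneg h0]
  rcases h0.eq_or_lt with h0 | h0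
  · have h1 := hF z hz
    rw [Complex.conj_eq_iff_im.2 h0.symm, eq_comm] at h1
    have h2 := Complex.conj_eq_iff_im.1 h1
    rw [toSlice_of_im_eq_zero _ h2, toSlice_of_im_eq_zero _ h2]
  · rw [unitOf_toSlice_of_pos hJ h0]

theorem exists_isLift_of_intrinsic {f : ℍ[ℝ] → ℍ[ℝ]} (hf : Intrinsic unitBall f) :
    ∃ F : ℂ → ℂ, DifferentiableOn ℂ F (ball 0 1) ∧ IsLift f F := by
  have hd : ∀ J ∈ imagUnits, DifferentiableOn ℂ (fun z => sliceProj J (f (toSlice J z)))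
    (ball 0 1) := fun J hJ => differentiableOn_sliceProj hf.1 hJ
  have hm : ∀ J ∈ imagUnits, ∀ z ∈ ball (0 : ℂ) 1,
      ∃ w, f (toSlice J z) = toSlice J w := fun J hJ z hz => by
    have := hf.2 J hJ ⟨(toSlice_mem_unitBall hJ).2 hz, z.re, z.im, rfl⟩
    rw [slicePlane_eq_range] at this
    obtain ⟨w, hw⟩ := this
    exact ⟨w, hw.symm⟩
  -- At a real point the value lies in both `ℂ_i` and `ℂ_j`, hence in `ℝ`.
  have hreal : ∀ x : ℝ, (x : ℂ) ∈ ball (0 : ℂ) 1 → ∃ c : ℝ, f (x : ℍ[ℝ]) = (c : ℍ[ℝ]) :=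
    fun x hx => by
      obtain ⟨w, hw⟩ := hm unitI unitI_mem x hx
      obtain ⟨v, hv⟩ := hm unitJ unitJ_mem x hx
      rw [toSlice_ofReal] at hw hv
      have h1 := congrArg QuaternionAlgebra.imI (hw.symm.trans hv)
      have h2 : w.im = 0 := by
        simp only [toSlice_eq_smul, Quaternion.imI_add, Quaternion.imI_coe, Quaternion.imI_smul,
          zero_add, smul_eq_mul] at h1
        simpa [unitI, unitJ] using h1
      exact ⟨w.re, by rw [hw, toSlice_of_im_eq_zero _ h2]⟩
  refine ⟨fun z => sliceProj unitI (f (toSlice unitI z)), hd _ unitI_mem, fun J hJ z hz => ?_⟩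
  have h0 : (0 : ℂ) ∈ ball (0 : ℂ) 1 := mem_ball_self one_pos
  -- The projections on the slices `J` and `i` agree at the real points near `0`, which accumulate
  -- at `0`.
  have heq := (AnalyticOnNhd.eqOn_of_preconnected_of_frequently_eq
    ((hd J hJ).analyticOnNhd isOpen_ball) ((hd _ unitI_mem).analyticOnNhd isOpen_ball)
    (convex_ball (0 : ℂ) 1).isPreconnected h0 (by
      have h1 : Tendsto (fun x : ℝ => (x : ℂ)) (𝓝[≠] 0) (𝓝[≠] 0) := by
        refine tendsto_nhdsWithin_iff.2 ⟨?_, ?_⟩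
        · exact (Complex.continuous_ofReal.tendsto' 0 0 Complex.ofReal_zero).mono_left
            nhdsWithin_le_nhds
        · filter_upwards [self_mem_nhdsWithin] with x hx
          simpa using hx
      refine h1.frequently (Eventually.frequently ?_)
      filter_upwards [(h1.mono_right nhdsWithin_le_nhds).eventually
        (isOpen_ball.mem_nhds h0)] with x hx
      obtain ⟨c, hc⟩ := hreal x hx
      have h2 : ∀ K ∈ imagUnits, sliceProj K (f (toSlice K (x : ℂ))) = c := fun K hK => by
        rw [toSlice_ofReal, hc, ← toSlice_ofReal K, sliceProj_toSlice hK]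
      rw [h2 J hJ, h2 _ unitI_mem])) hz
  simp only at heq
  obtain ⟨w, hw⟩ := hm J hJ z hz
  rw [hw, sliceProj_toSlice hJ] at heq
  rw [hw, heq]

/-! ### Complex characterizations of convex and starlike functions -/

theorem convex_iff_exists_exp {F : ℂ → ℂ} (hF : DifferentiableOn ℂ F (ball 0 1))
    (hF1 : deriv F 0 = 1) :
    (InjOn F (ball 0 1) ∧ Convex ℝ (F '' ball 0 1)) ↔
      ∃ H : ℂ → ℂ, DifferentiableOn ℂ H (ball 0 1) ∧
        (∀ z ∈ ball (0 : ℂ) 1, HasDerivAt F (Complex.exp (H z)) z) ∧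
        ∀ z ∈ ball (0 : ℂ) 1, 0 < (1 + z * deriv H z).re :=
  ⟨fun h => exists_exp_of_convex hF h.1 hF1 h.2, fun ⟨_, hH, h1, h2⟩ =>
    ⟨injOn_of_convexity hH h1 h2, convex_image_of_convexity hH h1 h2⟩⟩

theorem starlike_iff_exists_exp {F : ℂ → ℂ} (hF : DifferentiableOn ℂ F (ball 0 1))
    (hF0 : F 0 = 0) (hF1 : deriv F 0 = 1) :
    (InjOn F (ball 0 1) ∧ StarConvex ℝ 0 (F '' ball 0 1)) ↔
      ∃ H : ℂ → ℂ, DifferentiableOn ℂ H (ball 0 1) ∧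
        (∀ z ∈ ball (0 : ℂ) 1, F z = z * Complex.exp (H z)) ∧
        ∀ z ∈ ball (0 : ℂ) 1, 0 < (1 + z * deriv H z).re := by
  refine ⟨fun h => exists_exp_of_starConvex hF h.1 hF0 hF1 h.2, fun ⟨H, hH, h1, h2⟩ => ?_⟩
  have heq : EqOn F (fun z => z * Complex.exp (H z)) (ball 0 1) := h1
  rw [heq.image_eq, heq.injOn_iff]
  exact ⟨injOn_id_mul_exp hH h2, starConvex_id_mul_exp hH h2⟩

/-- Alexander's theorem. -/
theorem convex_iff_starlike_id_mul_deriv {F : ℂ → ℂ} (hF : DifferentiableOn ℂ F (ball 0 1))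
    (hF1 : deriv F 0 = 1) :
    (InjOn F (ball 0 1) ∧ Convex ℝ (F '' ball 0 1)) ↔
      (InjOn (fun z => z * deriv F z) (ball 0 1) ∧
        StarConvex ℝ 0 ((fun z => z * deriv F z) '' ball 0 1)) := by
  have h0 : (0 : ℂ) ∈ ball (0 : ℂ) 1 := mem_ball_self one_pos
  have hd := hF.deriv isOpen_ball
  have hG1 : deriv (fun z => z * deriv F z) 0 = 1 := by
    have : HasDerivAt (fun z => z * deriv F z) (1 * deriv F 0 + 0 * deriv (deriv F) 0) 0 :=
      (hasDerivAt_id (0 : ℂ)).mul (hd.differentiableAt (isOpen_ball.mem_nhds h0)).hasDerivAt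
    rw [this.deriv, hF1]; simp
  rw [convex_iff_exists_exp hF hF1,
    starlike_iff_exists_exp (F := fun z => z * deriv F z) (differentiableOn_id.mul hd) (by simp) hG1]
  constructor
  · rintro ⟨H, hH, h1, h2⟩
    exact ⟨H, hH, fun z hz => by rw [(h1 z hz).deriv], h2⟩
  · rintro ⟨H, hH, h1, h2⟩
    refine ⟨H, hH, fun z hz => ?_, h2⟩
    have h3 : deriv F z = Complex.exp (H z) := by
      rcases eq_or_ne z 0 with rfl | hz0
      · have h4 := ((hasDerivAt_id_mul_exp hH h0).congr_of_eventuallyEq (by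
          filter_upwards [isOpen_ball.mem_nhds h0] with w hw using h1 w hw)).deriv
        rw [hG1] at h4
        rw [hF1, h4]; simp
      · exact mul_left_cancel₀ hz0 (h1 z hz)
    rw [← h3]
    exact (hF.differentiableAt (isOpen_ball.mem_nhds hz)).hasDerivAt

/-- The quotient `g = F / z` satisfies `z g' = (P - 1) g` off its zeros. Hence `g` is an
exponential: the zeros left out of the hypothesis do not exist, apart from the origin. -/
theorem starlike_of_caratheodory {F : ℂ → ℂ} (hF : DifferentiableOn ℂ F (ball 0 1))
    (hF0 : F 0 = 0) (hF1 : deriv F 0 = 1) {P : ℂ → ℂ} (hP : DifferentiableOn ℂ P (ball 0 1))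
    (hP0 : P 0 = 1) (hpos : ∀ z ∈ ball (0 : ℂ) 1, 0 < (P z).re)
    (h : ∀ z ∈ ball (0 : ℂ) 1, F z ≠ 0 → P z = z * deriv F z * (F z)⁻¹) :
    InjOn F (ball 0 1) ∧ StarConvex ℝ 0 (F '' ball 0 1) := by
  have h0 : (0 : ℂ) ∈ ball (0 : ℂ) 1 := mem_ball_self one_pos
  have hFg : ∀ z, F z = z * dslope F 0 z := fun z => by
    have := sub_smul_dslope F 0 z
    simp only [sub_zero, smul_eq_mul, hF0] at this
    exact this.symm
  have hg : DifferentiableOn ℂ (dslope F 0) (ball 0 1) :=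
    (Complex.differentiableOn_dslope (isOpen_ball.mem_nhds h0)).2 hF
  have hd : ∀ z ∈ ball (0 : ℂ) 1, deriv F z = dslope F 0 z + z * deriv (dslope F 0) z :=
    fun z hz => by
      have h1 := (hasDerivAt_id z).mul
        (hg.differentiableAt (isOpen_ball.mem_nhds hz)).hasDerivAt
      have h2 : HasDerivAt F (1 * dslope F 0 z + z * deriv (dslope F 0) z) z :=
        h1.congr_of_eventuallyEq (Eventually.of_forall hFg)
      rw [h2.deriv, one_mul]
  obtain ⟨H, hH, -, h1, h2⟩ := exists_exp_of_mul_deriv hg hP (by rw [dslope_same, hF1]) hP0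
    fun z hz hne => by
      rcases eq_or_ne z 0 with rfl | hz0
      · rw [hP0]; ring
      have h3 := h z hz (by rw [hFg z]; exact mul_ne_zero hz0 hne)
      rw [hd z hz, hFg z] at h3
      rw [h3]
      field_simp
      ring
  exact (starlike_iff_exists_exp hF hF0 hF1).2 ⟨H, hH, fun z hz => by rw [← h1 z hz, ← hFg z],
    fun z hz => by rw [← h2 z hz]; exact hpos z hz⟩

theorem convex_of_caratheodory {F : ℂ → ℂ} (hF : DifferentiableOn ℂ F (ball 0 1))
    (hF1 : deriv F 0 = 1) {P : ℂ → ℂ} (hP : DifferentiableOn ℂ P (ball 0 1))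
    (hP0 : P 0 = 1) (hpos : ∀ z ∈ ball (0 : ℂ) 1, 0 < (P z).re)
    (h : ∀ z ∈ ball (0 : ℂ) 1, deriv F z ≠ 0 →
      P z = 1 + z * deriv (deriv F) z * (deriv F z)⁻¹) :
    InjOn F (ball 0 1) ∧ Convex ℝ (F '' ball 0 1) := by
  obtain ⟨H, hH, -, h1, h2⟩ := exists_exp_of_mul_deriv (hF.deriv isOpen_ball) hP hF1 hP0
    fun z hz hne => by
      rw [h z hz hne]
      field_simp
      ring
  exact (convex_iff_exists_exp hF hF1).2 ⟨H, hH, fun z hz => by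
    rw [← h1 z hz]
    exact (hF.differentiableAt (isOpen_ball.mem_nhds hz)).hasDerivAt,
    fun z hz => by rw [← h2 z hz]; exact hpos z hz⟩

/-! ### Transfer between the disc and the ball -/

theorem IsLift.symmetrization_ne_zero_iff {g : ℍ[ℝ] → ℍ[ℝ]} {G : ℂ → ℂ} (hg : IsLift g G)
    {J : ℍ[ℝ]} (hJ : J ∈ imagUnits) {z : ℂ} (hz : z ∈ ball (0 : ℂ) 1) :
    SliceQuat.symmetrization g (toSlice J z) ≠ 0 ↔ G z ≠ 0 := by
  rw [hg.symmetrization J hJ z hz, ← toSlice_zero J, (toSlice_injective hJ).ne_iff,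
    mul_self_ne_zero]

/-- The function `p` is not assumed intrinsic, so it need not be a lift. Its projection to `ℂ_J` is
still holomorphic, has the same real part, and agrees with `K` wherever `p` is prescribed. -/
theorem exists_of_belongsToCaratheodory {g h : ℍ[ℝ] → ℍ[ℝ]} {G K : ℂ → ℂ} (hg : IsLift g G)
    (hh : IsLift h K) {J : ℍ[ℝ]} (hJ : J ∈ imagUnits) (hb : BelongsToCaratheodory J g h) :
    ∃ P : ℂ → ℂ, DifferentiableOn ℂ P (ball 0 1) ∧ P 0 = 1 ∧
      (∀ z ∈ ball (0 : ℂ) 1, 0 < (P z).re) ∧ ∀ z ∈ ball (0 : ℂ) 1, G z ≠ 0 → P z = K z := by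
  obtain ⟨p, ⟨hp, hpos, hp0⟩, hph⟩ := hb
  refine ⟨fun z => sliceProj J (p (toSlice J z)), differentiableOn_sliceProj hp hJ, ?_,
    fun z hz => ?_, fun z hz hne => ?_⟩
  · simp only [toSlice_zero, hp0]
    rw [← toSlice_one J, sliceProj_toSlice hJ]
  · rw [re_sliceProj]
    exact hpos _ (by rw [sliceDisc_eq_image hJ]; exact mem_image_of_mem _ hz)
  · simp only
    rw [hph _ ((toSlice_mem_unitBall hJ).2 hz) ((hg.symmetrization_ne_zero_iff hJ hz).2 hne),
      hh J hJ z hz, sliceProj_toSlice hJ]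

theorem belongsToCaratheodory_of {g h : ℍ[ℝ] → ℍ[ℝ]} {G K P : ℂ → ℂ} (hg : IsLift g G)
    (hh : IsLift h K) {J : ℍ[ℝ]} (hJ : J ∈ imagUnits) (hP : DifferentiableOn ℂ P (ball 0 1))
    (hPc : ∀ z ∈ ball (0 : ℂ) 1, P (conj z) = conj (P z)) (hP0 : P 0 = 1)
    (hpos : ∀ z ∈ ball (0 : ℂ) 1, 0 < (P z).re)
    (hK : ∀ z ∈ ball (0 : ℂ) 1, G z ≠ 0 → P z = K z) : BelongsToCaratheodory J g h := by
  have hp := isLift_liftFun hPc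
  refine ⟨liftFun P, ⟨hp.sliceRegularOn hP, fun q hq => ?_, ?_⟩, fun q hq hne => ?_⟩
  · rw [sliceDisc_eq_image hJ] at hq
    obtain ⟨z, hz, rfl⟩ := hq
    rw [hp J hJ z hz, re_toSlice hJ]
    exact hpos z hz
  · have := hp J hJ 0 (mem_ball_self one_pos)
    rwa [toSlice_zero, hP0, toSlice_one] at this
  · obtain ⟨K', hK', z, hz, rfl⟩ := mem_unitBall_iff.1 hq
    rw [hp K' hK' z hz, hh K' hK' z hz, hK z hz ((hg.symmetrization_ne_zero_iff hK' hz).1 hne)]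

theorem IsLift.map_zero {f : ℍ[ℝ] → ℍ[ℝ]} {F : ℂ → ℂ} (hf : IsLift f F) :
    f 0 = toSlice unitI (F 0) := by
  have := hf unitI unitI_mem 0 (mem_ball_self one_pos)
  rwa [toSlice_zero] at this

theorem IsLift.normalized {f : ℍ[ℝ] → ℍ[ℝ]} {F : ℂ → ℂ} (hf : IsLift f F)
    (hF : DifferentiableOn ℂ F (ball 0 1)) (hF0 : F 0 = 0) (hF1 : deriv F 0 = 1) :
    Normalized f :=
  ⟨hf.sliceRegularOn hF, by rw [hf.map_zero, hF0, toSlice_zero],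
    by rw [(hf.sliceDeriv hF).map_zero, hF1, toSlice_one]⟩

theorem IsLift.image_sliceDisc {f : ℍ[ℝ] → ℍ[ℝ]} {F : ℂ → ℂ} (hf : IsLift f F) {J : ℍ[ℝ]}
    (hJ : J ∈ imagUnits) : f '' sliceDisc J = toSlice J '' (F '' ball 0 1) := by
  rw [sliceDisc_eq_image hJ, image_image, image_image]
  exact image_congr fun z hz => hf J hJ z hz

theorem IsLift.injOn_sliceDisc {f : ℍ[ℝ] → ℍ[ℝ]} {F : ℂ → ℂ} (hf : IsLift f F) {J : ℍ[ℝ]}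
    (hJ : J ∈ imagUnits) : InjOn f (sliceDisc J) ↔ InjOn F (ball 0 1) := by
  rw [sliceDisc_eq_image hJ]
  constructor
  · intro h z hz w hw hzw
    refine toSlice_injective hJ (h (mem_image_of_mem _ hz) (mem_image_of_mem _ hw) ?_)
    rw [hf J hJ z hz, hf J hJ w hw, hzw]
  · rintro h _ ⟨z, hz, rfl⟩ _ ⟨w, hw, rfl⟩ hzw
    rw [hf J hJ z hz, hf J hJ w hw] at hzw
    rw [h hz hw (toSlice_injective hJ hzw)]

theorem IsLift.isSliceConvex_iff {f : ℍ[ℝ] → ℍ[ℝ]} {F : ℂ → ℂ} (hf : IsLift f F)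
    (hn : Normalized f) {J : ℍ[ℝ]} (hJ : J ∈ imagUnits) :
    IsSliceConvex J f ↔ InjOn F (ball 0 1) ∧ Convex ℝ (F '' ball 0 1) := by
  rw [IsSliceConvex, hf.injOn_sliceDisc hJ, hf.image_sliceDisc hJ]
  refine ⟨fun h => ⟨h.2.1, ?_⟩, fun h => ⟨hn, h.1, h.2.linear_image (toSliceCLM J).toLinearMap⟩⟩
  have := h.2.2.linear_preimage (toSliceCLM J).toLinearMap
  change Convex ℝ (toSlice J ⁻¹' (toSlice J '' (F '' ball 0 1))) at this
  rwa [preimage_image_eq _ (toSlice_injective hJ)] at this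

theorem starConvex_toSlice_image_iff {J : ℍ[ℝ]} (hJ : J ∈ imagUnits) {s : Set ℂ} :
    StarConvex ℝ 0 (toSlice J '' s) ↔ StarConvex ℝ 0 s := by
  rw [starConvex_zero_iff, starConvex_zero_iff]
  constructor
  · intro h z hz a ha0 ha1
    obtain ⟨w, hw, hwz⟩ := h (mem_image_of_mem _ hz) ha0 ha1
    rw [← toSlice_smul] at hwz
    rwa [← toSlice_injective hJ hwz]
  · rintro h _ ⟨z, hz, rfl⟩ a ha0 ha1
    exact ⟨a • z, h hz ha0 ha1, toSlice_smul J a z⟩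

theorem IsLift.isSliceStarlike_iff {f : ℍ[ℝ] → ℍ[ℝ]} {F : ℂ → ℂ} (hf : IsLift f F)
    (hn : Normalized f) {J : ℍ[ℝ]} (hJ : J ∈ imagUnits) :
    IsSliceStarlike J f ↔ InjOn F (ball 0 1) ∧ StarConvex ℝ 0 (F '' ball 0 1) := by
  rw [IsSliceStarlike, hf.injOn_sliceDisc hJ, hf.image_sliceDisc hJ,
    starConvex_toSlice_image_iff hJ]
  exact ⟨fun h => h.2, fun h => ⟨hn, h⟩⟩

/-- Injectivity and symmetry imply that `F z` is real only for real `z`. A common value of `f`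
therefore determines the slice, or is real and comes from real points. -/
theorem IsLift.injOn_unitBall {f : ℍ[ℝ] → ℍ[ℝ]} {F : ℂ → ℂ} (hf : IsLift f F)
    (hinj : InjOn F (ball 0 1)) : InjOn f unitBall := by
  intro p hp q hq hpq
  obtain ⟨J, hJ, z, hz, rfl⟩ := mem_unitBall_iff.1 hp
  obtain ⟨K, hK, w, hw, rfl⟩ := mem_unitBall_iff.1 hq
  rw [hf J hJ z hz, hf K hK w hw] at hpq
  have hre : ∀ z ∈ ball (0 : ℂ) 1, (F z).im = 0 → z.im = 0 := fun z hz h => by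
    rw [← Complex.conj_eq_iff_im] at h ⊢
    rw [← hf.map_conj hz] at h
    exact hinj (conj_mem_ball hz) hz h
  have hreal : (F z).im = 0 → z.re = w.re → w.im = 0 → toSlice J z = toSlice K w :=
    fun h1 h2 h3 => by
      rw [toSlice_of_im_eq_zero _ (hre z hz h1), toSlice_of_im_eq_zero _ h3, h2]
  rcases toSlice_eq_toSlice hJ hK hpq with ⟨h1, h2⟩ | ⟨h1, h2⟩
  · have h3 := hinj hz hw h1
    subst h3
    by_cases h4 : (F z).im = 0
    · exact hreal h4 rfl (hre z hz h4)
    · rw [h2 h4]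
  · rw [← hf.map_conj hw] at h1
    have h3 := hinj hz (conj_mem_ball hw) h1
    by_cases h4 : (F z).im = 0
    · refine hreal h4 (by rw [h3, Complex.conj_re]) ?_
      have := hre z hz h4
      rw [h3, Complex.conj_im, neg_eq_zero] at this
      exact this
    · rw [h2 h4, h3, toSlice_neg_conj]

theorem IsLift.isStarlike_iff {f : ℍ[ℝ] → ℍ[ℝ]} {F : ℂ → ℂ} (hf : IsLift f F)
    (hn : Normalized f) :
    IsStarlike f ↔ InjOn F (ball 0 1) ∧ StarConvex ℝ 0 (F '' ball 0 1) := by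
  constructor
  · rintro ⟨-, hinj, hs⟩
    refine ⟨(hf.injOn_sliceDisc unitI_mem).1 (hinj.mono inter_subset_left), ?_⟩
    rw [starConvex_zero_iff] at hs ⊢
    rintro _ ⟨z, hz, rfl⟩ a ha0 ha1
    obtain ⟨q, hq, hqz⟩ := hs (mem_image_of_mem f ((toSlice_mem_unitBall unitI_mem).2 hz)) ha0 ha1
    obtain ⟨K, hK, w, hw, rfl⟩ := mem_unitBall_iff.1 hq
    rw [hf K hK w hw, hf _ unitI_mem z hz, ← toSlice_smul] at hqz
    -- The preimage in the ball may use another unit, but its image is a point of `ℂ_i`; up to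
    -- conjugation, which `F` respects, it gives a preimage in the disc.
    rcases toSlice_eq_toSlice hK unitI_mem hqz with ⟨h1, -⟩ | ⟨h1, -⟩
    · exact ⟨w, hw, h1⟩
    · exact ⟨conj w, conj_mem_ball hw, by rw [hf.map_conj hw, h1, Complex.conj_conj]⟩
  · rintro ⟨hinj, hs⟩
    refine ⟨hn, hf.injOn_unitBall hinj, ?_⟩
    rw [starConvex_zero_iff] at hs ⊢
    rintro _ ⟨q, hq, rfl⟩ a ha0 ha1
    obtain ⟨K, hK, w, hw, rfl⟩ := mem_unitBall_iff.1 hq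
    obtain ⟨v, hv, hvw⟩ := hs (mem_image_of_mem F hw) ha0 ha1
    refine ⟨toSlice K v, (toSlice_mem_unitBall hK).2 hv, ?_⟩
    rw [hf K hK v hv, hvw, hf K hK w hw, toSlice_smul]

/-! ### Rotations and the assertions for intrinsic functions -/

theorem expI_zero (J : ℍ[ℝ]) : expI J 0 = 1 := by simp [expI, pt]

theorem expI_pi (J : ℍ[ℝ]) : expI J Real.pi = -1 := by simp [expI, pt]

theorem expI_neg_pi (J : ℍ[ℝ]) : expI J (-Real.pi) = -1 := by simp [expI, pt]

/-- Real factors of modulus one correspond to the angles `0` and `π`, for which the imaginary unit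
is irrelevant. -/
theorem isRotationOf_of_eq_one_or_neg_one {f g : ℍ[ℝ] → ℍ[ℝ]} {ε : ℝ} (hε : ε = 1 ∨ ε = -1)
    (h : ∀ q ∈ unitBall, f q = (ε : ℍ[ℝ]) * g ((ε : ℍ[ℝ]) * q)) : IsRotationOf f g := by
  rcases hε with rfl | rfl
  · exact ⟨unitI, unitI_mem, 0, fun q hq => by rw [h q hq, neg_zero, expI_zero]; simp⟩
  · exact ⟨unitI, unitI_mem, Real.pi, fun q hq => by
      rw [h q hq, expI_neg_pi, expI_pi]; simp⟩

theorem koebe_toSlice {J : ℍ[ℝ]} (hJ : J ∈ imagUnits) (z : ℂ) :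
    koebe (toSlice J z) = toSlice J (z * ((1 - z) ^ 2)⁻¹) := by
  simp only [koebe, ← toSliceHom_apply hJ, map_mul, map_inv₀, map_pow, map_sub, map_one]

theorem halfSpaceMap_toSlice {J : ℍ[ℝ]} (hJ : J ∈ imagUnits) (z : ℂ) :
    halfSpaceMap (toSlice J z) = toSlice J (z * (1 - z)⁻¹) := by
  simp only [halfSpaceMap, ← toSliceHom_apply hJ, map_mul, map_inv₀, map_sub, map_one]

theorem IsLift.isRotationOf {f g : ℍ[ℝ] → ℍ[ℝ]} {F G : ℂ → ℂ} (hf : IsLift f F)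
    (hg : ∀ J ∈ imagUnits, ∀ z, g (toSlice J z) = toSlice J (G z)) {ε : ℝ}
    (hε : ε = 1 ∨ ε = -1) (h : ∀ z ∈ ball (0 : ℂ) 1, F z = ε * G (ε * z)) :
    IsRotationOf f g := by
  refine isRotationOf_of_eq_one_or_neg_one hε fun q hq => ?_
  obtain ⟨J, hJ, z, hz, rfl⟩ := mem_unitBall_iff.1 hq
  rw [hf J hJ z hz, ← toSlice_ofReal J, ← toSlice_mul hJ, hg J hJ, ← toSlice_mul hJ, h z hz]

theorem eq_one_or_eq_neg_one_of_norm {c : ℂ} (hc : c = (c.re : ℂ)) (h : ‖c‖ = 1) :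
    c.re = 1 ∨ c.re = -1 := by
  rw [hc, Complex.norm_real, Real.norm_eq_abs] at h
  exact eq_or_eq_neg_of_abs_eq h

theorem IsLift.isStarlike_iff_belongs {f : ℍ[ℝ] → ℍ[ℝ]} {F : ℂ → ℂ} (hf : IsLift f F)
    (hF : DifferentiableOn ℂ F (ball 0 1)) (hF0 : F 0 = 0) (hF1 : deriv F 0 = 1) :
    IsStarlike f ↔ ∀ J ∈ imagUnits, BelongsToCaratheodory J f
      (SliceQuat.starMul (fun q => q * SliceQuat.sliceDeriv f q) (SliceQuat.starInv f)) := by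
  have hK : IsLift (SliceQuat.starMul (fun q => q * SliceQuat.sliceDeriv f q)
      (SliceQuat.starInv f)) (fun z => z * deriv F z * (F z)⁻¹) :=
    (isLift_id.mul (hf.sliceDeriv hF)).starMul hf.starInv
  rw [hf.isStarlike_iff (hf.normalized hF hF0 hF1)]
  constructor
  · intro h J hJ
    obtain ⟨H, hH, h1, h2⟩ := (starlike_iff_exists_exp hF hF0 hF1).1 h
    have h3 : ∀ z ∈ ball (0 : ℂ) 1, z ≠ 0 → F z ≠ 0 := fun z hz hz0 => by
      rw [h1 z hz]
      exact mul_ne_zero hz0 (Complex.exp_ne_zero _)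
    have h4 : ∀ z ∈ ball (0 : ℂ) 1, z ≠ 0 → 1 + z * deriv H z = z * deriv F z * (F z)⁻¹ :=
      fun z hz hz0 => by
        have h5 := ((hasDerivAt_id_mul_exp hH hz).congr_of_eventuallyEq (by
          filter_upwards [isOpen_ball.mem_nhds hz] with w hw using h1 w hw)).deriv
        rw [h5, h1 z hz]
        have := Complex.exp_ne_zero (H z)
        field_simp
    refine belongsToCaratheodory_of hf hK hJ (differentiableOn_one_add_id_mul_deriv hH)
      (fun z hz => ?_) (by simp) h2 fun z hz hne => h4 z hz ?_
    · rcases eq_or_ne z 0 with rfl | hz0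
      · simp
      · rw [h4 z hz hz0, h4 _ (conj_mem_ball hz) (by simpa using hz0)]
        exact hK.map_conj hz
    · rintro rfl
      exact hne hF0
  · intro h
    -- A single imaginary unit suffices, because `F` is the same on all slices.
    obtain ⟨P, h1, h2, h3, h4⟩ := exists_of_belongsToCaratheodory hf hK unitI_mem
      (h _ unitI_mem)
    exact starlike_of_caratheodory hF hF0 hF1 h1 h2 h3 h4

theorem IsLift.isSliceConvex_iff_belongs {f : ℍ[ℝ] → ℍ[ℝ]} {F : ℂ → ℂ} (hf : IsLift f F)
    (hF : DifferentiableOn ℂ F (ball 0 1)) (hF0 : F 0 = 0) (hF1 : deriv F 0 = 1) {J : ℍ[ℝ]}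
    (hJ : J ∈ imagUnits) :
    IsSliceConvex J f ↔ BelongsToCaratheodory J (SliceQuat.sliceDeriv f)
      (fun q => 1 + SliceQuat.starMul
        (fun w => w * SliceQuat.sliceDeriv (SliceQuat.sliceDeriv f) w)
        (SliceQuat.starInv (SliceQuat.sliceDeriv f)) q) := by
  have hf' := hf.sliceDeriv hF
  have hK := isLift_one.add
    ((isLift_id.mul (hf'.sliceDeriv (hF.deriv isOpen_ball))).starMul hf'.starInv)
  rw [hf.isSliceConvex_iff (hf.normalized hF hF0 hF1) hJ]
  constructor
  · intro h
    obtain ⟨H, hH, h1, h2⟩ := (convex_iff_exists_exp hF hF1).1 h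
    have h4 : ∀ z ∈ ball (0 : ℂ) 1,
        1 + z * deriv H z = 1 + z * deriv (deriv F) z * (deriv F z)⁻¹ := fun z hz => by
      have h5 := ((hH.differentiableAt (isOpen_ball.mem_nhds hz)).hasDerivAt.cexp
        |>.congr_of_eventuallyEq (show deriv F =ᶠ[𝓝 z] fun w => Complex.exp (H w) by
          filter_upwards [isOpen_ball.mem_nhds hz] with w hw using (h1 w hw).deriv)).deriv
      rw [h5, (h1 z hz).deriv]
      have := Complex.exp_ne_zero (H z)
      field_simp
    refine belongsToCaratheodory_of hf' hK hJ (differentiableOn_one_add_id_mul_deriv hH)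
      (fun z hz => ?_) (by simp) h2 fun z hz _ => h4 z hz
    rw [h4 z hz, h4 _ (conj_mem_ball hz)]
    exact hK.map_conj hz
  · intro h
    obtain ⟨P, h1, h2, h3, h4⟩ := exists_of_belongsToCaratheodory hf' hK hJ h
    exact convex_of_caratheodory hF hF1 h1 h2 h3 h4

theorem IsLift.isSliceConvex_iff_isSliceStarlike {f : ℍ[ℝ] → ℍ[ℝ]} {F : ℂ → ℂ}
    (hf : IsLift f F) (hF : DifferentiableOn ℂ F (ball 0 1)) (hF0 : F 0 = 0)
    (hF1 : deriv F 0 = 1) {J : ℍ[ℝ]} (hJ : J ∈ imagUnits) :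
    IsSliceConvex J f ↔
      IsSliceStarlike J (SliceQuat.starMul (fun q => q) (SliceQuat.sliceDeriv f)) := by
  have hg : IsLift (SliceQuat.starMul (fun q => q) (SliceQuat.sliceDeriv f))
      (fun z => z * deriv F z) := isLift_id.starMul (hf.sliceDeriv hF)
  have h0 : (0 : ℂ) ∈ ball (0 : ℂ) 1 := mem_ball_self one_pos
  have hd := hF.deriv isOpen_ball
  have hG : HasDerivAt (fun z => z * deriv F z) (1 * deriv F 0 + 0 * deriv (deriv F) 0) 0 :=
    (hasDerivAt_id (0 : ℂ)).mul (hd.differentiableAt (isOpen_ball.mem_nhds h0)).hasDerivAt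
  rw [hf.isSliceConvex_iff (hf.normalized hF hF0 hF1) hJ,
    hg.isSliceStarlike_iff (hg.normalized (differentiableOn_id.mul hd) (by simp)
      (by rw [hG.deriv, hF1]; simp)) hJ]
  exact convex_iff_starlike_id_mul_deriv hF hF1

theorem IsLift.norm_coeff {f : ℍ[ℝ] → ℍ[ℝ]} {F : ℂ → ℂ} (hf : IsLift f F)
    (hF : DifferentiableOn ℂ F (ball 0 1)) (n : ℕ) :
    ‖((taylorCoeff F n).re : ℍ[ℝ])‖ = ‖taylorCoeff F n‖ := by
  conv_rhs => rw [hf.taylorCoeff_eq hF n]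
  rw [Quaternion.norm_coe, Complex.norm_real]

theorem IsLift.starlike_coefficients {f : ℍ[ℝ] → ℍ[ℝ]} {F : ℂ → ℂ} (hf : IsLift f F)
    (hF : DifferentiableOn ℂ F (ball 0 1)) (hF0 : F 0 = 0) (hF1 : deriv F 0 = 1)
    (hs : IsStarlike f) : (∀ n, ‖((taylorCoeff F n).re : ℍ[ℝ])‖ ≤ n) ∧
      (¬ IsRotationOf f koebe → ∀ n, 2 ≤ n → ‖((taylorCoeff F n).re : ℍ[ℝ])‖ < n) := by
  obtain ⟨H, hH, h1, h2⟩ := (starlike_iff_exists_exp hF hF0 hF1).1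
    ((hf.isStarlike_iff (hf.normalized hF hF0 hF1)).1 hs)
  obtain ⟨h3, h4⟩ := SliceQuat.starlike_coefficients hH h1 hF1 h2
  simp only [hf.norm_coeff hF]
  refine ⟨h3, fun hrot n hn => lt_of_le_of_ne (h3 n) fun heq => hrot ?_⟩
  obtain ⟨h5, h6⟩ := h4 n hn heq
  have h7 := hf.taylorCoeff_eq hF 2
  have h8 : taylorCoeff F 2 / 2 = ((taylorCoeff F 2 / 2).re : ℂ) := by
    conv_lhs => rw [h7]
    simp
  -- The extremal parameter `a_2 / 2` is real of modulus one, hence `±1`.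
  have hε := eq_one_or_eq_neg_one_of_norm h8 (by rw [norm_div, h5]; simp)
  refine hf.isRotationOf (G := fun z => z * ((1 - z) ^ 2)⁻¹) (fun J hJ z => koebe_toSlice hJ z)
    hε fun z hz => ?_
  have h9 := h6 z hz
  rw [h8] at h9
  rw [h1 z hz, eq_inv_of_mul_eq_one_left h9, ← mul_assoc, ← mul_assoc]
  rcases hε with h | h <;> rw [h] <;> simp

theorem IsLift.convex_coefficients {f : ℍ[ℝ] → ℍ[ℝ]} {F : ℂ → ℂ} (hf : IsLift f F)
    (hF : DifferentiableOn ℂ F (ball 0 1)) (hF0 : F 0 = 0) (hF1 : deriv F 0 = 1) {J : ℍ[ℝ]}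
    (hJ : J ∈ imagUnits) (hc : IsSliceConvex J f) :
    (∀ n, 2 ≤ n → ‖((taylorCoeff F n).re : ℍ[ℝ])‖ ≤ 1) ∧
      (¬ IsRotationOf f halfSpaceMap →
        ∀ n, 2 ≤ n → ‖((taylorCoeff F n).re : ℍ[ℝ])‖ < 1) := by
  obtain ⟨H, hH, h1, h2⟩ := (convex_iff_exists_exp hF hF1).1
    ((hf.isSliceConvex_iff (hf.normalized hF hF0 hF1) hJ).1 hc)
  obtain ⟨h3, h4⟩ := SliceQuat.convex_coefficients hH h1 hF0 hF1 h2
  simp only [hf.norm_coeff hF]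
  refine ⟨h3, fun hrot n hn => lt_of_le_of_ne (h3 n hn) fun heq => hrot ?_⟩
  obtain ⟨h5, h6⟩ := h4 n hn heq
  have h8 := hf.taylorCoeff_eq hF 2
  have hε := eq_one_or_eq_neg_one_of_norm h8 h5
  refine hf.isRotationOf (G := fun z => z * (1 - z)⁻¹) (fun J hJ z => halfSpaceMap_toSlice hJ z)
    hε fun z hz => ?_
  rw [(h6 z hz).2, h8, Complex.ofReal_re, ← mul_assoc, ← mul_assoc, div_eq_mul_inv]
  rcases hε with h | h <;> rw [h] <;> simp

theorem IsLift.ball_half_subset {f : ℍ[ℝ] → ℍ[ℝ]} {F : ℂ → ℂ} (hf : IsLift f F)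
    (hF : DifferentiableOn ℂ F (ball 0 1)) (hF0 : F 0 = 0) (hF1 : deriv F 0 = 1) {J : ℍ[ℝ]}
    (hJ : J ∈ imagUnits) (hc : IsSliceConvex J f) :
    ball 0 (1 / 2) ∩ slicePlane J ⊆ f '' sliceDisc J := by
  have h := (hf.isSliceConvex_iff (hf.normalized hF hF0 hF1) hJ).1 hc
  rw [hf.image_sliceDisc hJ, slicePlane_eq_range]
  rintro _ ⟨hq, z, rfl⟩
  rw [mem_ball_zero_iff, norm_toSlice hJ, ← mem_ball_zero_iff] at hq
  exact mem_image_of_mem _ (ball_half_subset_of_convex hF hF0 hF1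
    (exists_inverse_of_injOn isOpen_ball hF h.1).1 h.2 hq)

end SliceQuat

theorem mainTheorem10 (f : ℍ[ℝ] → ℍ[ℝ])
    (hf : SliceQuat.Intrinsic SliceQuat.unitBall f)
    (hf0 : f 0 = 0) (hf1 : SliceQuat.sliceDeriv f 0 = 1) :
    (SliceQuat.IsStarlike f ↔ ∀ I ∈ SliceQuat.imagUnits,
      SliceQuat.BelongsToCaratheodory I f
        (SliceQuat.starMul (fun q => q * SliceQuat.sliceDeriv f q) (SliceQuat.starInv f))) ∧
    (∀ I ∈ SliceQuat.imagUnits, (SliceQuat.IsSliceConvex I f ↔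
      SliceQuat.BelongsToCaratheodory I (SliceQuat.sliceDeriv f)
        (fun q => 1 + SliceQuat.starMul
          (fun w => w * SliceQuat.sliceDeriv (SliceQuat.sliceDeriv f) w)
          (SliceQuat.starInv (SliceQuat.sliceDeriv f)) q))) ∧
    (∀ I ∈ SliceQuat.imagUnits, (SliceQuat.IsSliceConvex I f ↔
      SliceQuat.IsSliceStarlike I (SliceQuat.starMul (fun q => q) (SliceQuat.sliceDeriv f)))) ∧
    (∃ a : ℕ → ℍ[ℝ],
      (∀ q ∈ SliceQuat.unitBall, HasSum (fun n => q ^ n * a n) (f q)) ∧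
      (SliceQuat.IsStarlike f →
        (∀ n, ‖a n‖ ≤ n) ∧
        (¬ SliceQuat.IsRotationOf f SliceQuat.koebe → ∀ n, 2 ≤ n → ‖a n‖ < n)) ∧
      (∀ I ∈ SliceQuat.imagUnits, SliceQuat.IsSliceConvex I f →
        (∀ n, 2 ≤ n → ‖a n‖ ≤ 1) ∧
        (¬ SliceQuat.IsRotationOf f SliceQuat.halfSpaceMap → ∀ n, 2 ≤ n → ‖a n‖ < 1))) ∧
    (∀ I ∈ SliceQuat.imagUnits, SliceQuat.IsSliceConvex I f →
      Metric.ball 0 (1 / 2) ∩ SliceQuat.slicePlane I ⊆ f '' SliceQuat.sliceDisc I) := by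
  obtain ⟨F, hF, hl⟩ := SliceQuat.exists_isLift_of_intrinsic hf
  have hinj := SliceQuat.toSlice_injective SliceQuat.unitI_mem
  have hF0 : F 0 = 0 := hinj (by rw [← hl.map_zero, hf0, SliceQuat.toSlice_zero])
  have hF1 : deriv F 0 = 1 := hinj (by
    rw [← (hl.sliceDeriv hF).map_zero, hf1, SliceQuat.toSlice_one])
  refine ⟨hl.isStarlike_iff_belongs hF hF0 hF1,
    fun I hI => hl.isSliceConvex_iff_belongs hF hF0 hF1 hI,
    fun I hI => hl.isSliceConvex_iff_isSliceStarlike hF hF0 hF1 hI,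
    ⟨fun n => ((SliceQuat.taylorCoeff F n).re : ℍ[ℝ]), fun q hq => ?_,
      hl.starlike_coefficients hF hF0 hF1,
      fun I hI => hl.convex_coefficients hF hF0 hF1 hI⟩,
    fun I hI => hl.ball_half_subset hF hF0 hF1 hI⟩
  -- The coefficients are real, so it does not matter on which side of `q ^ n` they stand.
  simp only [Quaternion.mul_coe_eq_smul]
  exact hl.hasSum hF hq
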